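/- **Setting.** Let $(\Omega,\mathcal F,\mathbb P)$ be a probability space with a filtration $\{\mathcal F_k\}_{k\ge0}$, and let $d\ge1$. Observations are $$y_{k+1}=S_k(\phi_k^{\mathrm T}\theta+\varepsilon_{k+1}),\qquad k\ge 0,$$ where $y_{k+1}$ is $\mathcal F_{k+1}$-measurable, $\theta\in\mathbb R^d$, and $S_k(x)=L_k$ for $x<l_k$, $S_k(x)=x$ for $l_k\le x\le u_k$, $S_k(x)=U_k$ for $x>u_k$. **Assumptions.** (1) $\phi_k\in\mathbb R^d$ is $\mathcal F_k$-measurable and $\{\phi_k\}$ is a.s. bounded in $k$; $\theta$ is an interior point of a known convex compact set $D\subset\mathbb R^d$; $C_k$ is $\mathcal F_k$-measurable with $\sup_{x\in D}|\phi_k^{\mathrm T}x|\le C_k$ a.s. (2) $l_k,u_k,L_k,U_k,b_k$ are $\mathcal F_k$-measurable; a.s., for all $k$, $L_k\le l_k\le u_k\le U_k$ and not $L_k=l_k=u_k=U_k$; $\sup_k\max\{l_k,-u_k\}\le M$ a.s. for a constant $M>0$; $0<\inf_k b_k\le\sup_k b_k\le1$ a.s. (3) Given $\mathcal F_k$, $\varepsilon_{k+1}$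 has conditional distribution function $F_{k+1}$ with $F_{k+1}(0)=\tfrac12$ and continuous conditional density $f_{k+1}$; there is a constant $C\ge\sup_kC_k$ such that a.s. $0<\inf f_{k+1}(x)\le\sup f_{k+1}(x)<\infty$, with $\inf$ and $\sup$ over $k\ge0$ and $|x|\le\max\{2C,C+M\}$. **Algorithm.** For positive definite $Q$ let $\|x\|_Q^2=x^{\mathrm T}Qx$ and $\Pi_Q(x)=\arg\min_{y\in D}\|x-y\|_Q$. For $t\in\mathbb R^d$ put $$v_{k+1}(t)=\operatorname{sgn}[y_{k+1}-S_k(\phi_k^{\mathrm T}t)]+F_{k+1}(u_k-\phi_k^{\mathrm T}t)\,\mathrm I_{[S_k(\phi_k^{\mathrm T}t)=U_k]}-[1-F_{k+1}(l_k-\phi_k^{\mathrm T}t)]\,\mathrm I_{[S_k(\phi_k^{\mathrm T}t)=L_k]}.$$ The estimates $\theta_k$ are generated for $k\ge 0$ by $$a_k=\frac1{\mu_k+\beta_kb_k^2\phi_k^{\mathrm T}P_k\phi_k},\quad P_{k+1}=P_k-a_k\beta_kb_k^2P_k\phi_k\phi_k^{\mathrm T}P_k,\quad \theta_{k+1}=\Pi_{P_{k+1}^{-1}}\{\theta_k+a_kb_kP_k\phi_kv_{k+1}(\theta_k)\},$$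 and preliminary estimates $\bar\theta_k$ by the same recursion with $\bar\mu_k,\bar\beta_k,\bar a_k,\bar P_k,\bar\theta_k$ in place of $\mu_k,\beta_k,a_k,P_k,\theta_k$. Here $\mu_k,\bar\mu_k$ are $\mathcal F_k$-measurable and a.s. bounded away from $0$ and $\infty$ in $k$; the initial values are $\mathcal F_0$-measurable with $\theta_0,\bar\theta_0\in D$ and $P_0,\bar P_0$ positive definite a.s.; $$\bar\beta_k=\inf\{f_{k+1}(x):|x|\le\max\{2C_k,C_k+l_k,C_k-u_k\}\};$$ and, with $d_k=\phi_k^{\mathrm T}(\bar\theta_k-\theta_k)$, for $d_k\ne0$ the gain $\beta_k$ equals $$\frac{F_{k+1}(l_k-\phi_k^{\mathrm T}\theta_k)-F_{k+1}(l_k-\phi_k^{\mathrm T}\bar\theta_k)}{d_k},\quad \frac{1-2F_{k+1}(\phi_k^{\mathrm T}\theta_k-\phi_k^{\mathrm T}\bar\theta_k)}{d_k},\quad \frac{F_{k+1}(u_k-\phi_k^{\mathrm T}\theta_k)-F_{k+1}(u_k-\phi_k^{\mathrm T}\bar\theta_k)}{d_k}$$ in the cases $S_k(\phi_k^{\mathrm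 T}\theta_k)=L_k$, $L_k<S_k(\phi_k^{\mathrm T}\theta_k)<U_k$, $S_k(\phi_k^{\mathrm T}\theta_k)=U_k$ respectively, and for $d_k=0$ it equals $f_{k+1}(l_k-\phi_k^{\mathrm T}\theta_k)$, $2f_{k+1}(0)$, $f_{k+1}(u_k-\phi_k^{\mathrm T}\theta_k)$ respectively. **Theorem.** Suppose in addition that the saturation functions are continuous, i.e. a.s. $l_k=L_k$ and $u_k=U_k$ for all $k$. Let $R_k=b_k|S_k(\phi_k^{\mathrm T}\theta)-S_k(\phi_k^{\mathrm T}\theta_k)|$ and let $\lambda_{\max}(n)$ be the largest eigenvalue of $P_0^{-1}+\sum_{i=0}^n\phi_i\phi_i^{\mathrm T}$. Then, almost surely on the event that $\lambda_{\max}(n)>1$ for some $n$, $$\frac1n\sum_{k=1}^nR_k=O\!\left(\sqrt{\frac{\log\lambda_{\max}(n)}{n}}\right)\qquad(n\to\infty).$$ No persistent-excitation condition is assumed. -/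

import Mathlib

open MeasureTheory Filter Matrix
open scoped Asymptotics

noncomputable section

namespace TSWLAD

/-- The saturation function with observable range `[l, u]` and outer values `L`, `U`. -/
def sat (l u L U x : ℝ) : ℝ :=
  if x < l then L else if x ≤ u then x else U

/-- The weighted norm `‖x‖_Q = √(xᵀ Q x)`. -/
def qnorm {d : ℕ} (Q : Matrix (Fin d) (Fin d) ℝ) (x : Fin d → ℝ) : ℝ :=
  Real.sqrt (x ⬝ᵥ (Q *ᵥ x))

/-- The projection `Π_Q(x) = argmin_{y ∈ D} ‖x - y‖_Q`. For `D` compact, convex and nonempty and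
`Q` positive definite the minimizer exists and is unique. -/
def proj {d : ℕ} (D : Set (Fin d → ℝ)) (Q : Matrix (Fin d) (Fin d) ℝ) (x : Fin d → ℝ) :
    Fin d → ℝ :=
  Classical.epsilon fun y => y ∈ D ∧ ∀ z ∈ D, qnorm Q (x - y) ≤ qnorm Q (x - z)

/-- The largest (real) eigenvalue of a symmetric matrix. -/
def lambdaMax {d : ℕ} (A : Matrix (Fin d) (Fin d) ℝ) : ℝ :=
  sSup {t : ℝ | Module.End.HasEigenvalue (Matrix.toLin' A) t}

/-- The data of the saturated stochastic model and of the two-step weighted least absolute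
deviation algorithm. Vectors of `ℝ^d` are functions `Fin d → ℝ`, with `φᵀθ = φ ⬝ᵥ θ`.
For processes whose natural index is `k + 1` (noise, conditional distribution function and
conditional density of the noise) the value at index `0` is never used. -/
structure Model (Ω : Type*) (d : ℕ) where
  /-- true parameter -/
  θ : Fin d → ℝ
  /-- known parameter set -/
  D : Set (Fin d → ℝ)
  /-- regressors `φ_k` -/
  φ : ℕ → Ω → Fin d → ℝ
  /-- noise `ε_{k+1}` -/
  ε : ℕ → Ω → ℝ
  /-- lower threshold `l_k` -/
  l : ℕ → Ω → ℝ
  /-- upper threshold `u_k` -/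
  u : ℕ → Ω → ℝ
  /-- lower saturation value `L_k` -/
  L : ℕ → Ω → ℝ
  /-- upper saturation value `U_k` -/
  U : ℕ → Ω → ℝ
  /-- weights `b_k` -/
  b : ℕ → Ω → ℝ
  /-- conditional distribution function `F_{k+1}` of `ε_{k+1}` given the past up to time `k` -/
  F : ℕ → Ω → ℝ → ℝ
  /-- conditional density `f_{k+1}` of `ε_{k+1}` given the past up to time `k` -/
  f : ℕ → Ω → ℝ → ℝ
  /-- known bounds `C_k` for `|φ_kᵀ x|`, `x ∈ D` -/
  C : ℕ → Ω → ℝ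
  /-- step-size factors of the first step -/
  muBar : ℕ → Ω → ℝ
  /-- step-size factors of the second step -/
  mu : ℕ → Ω → ℝ
  /-- initial estimate of the first step -/
  thetaBar₀ : Ω → Fin d → ℝ
  /-- initial gain matrix of the first step -/
  PBar₀ : Ω → Matrix (Fin d) (Fin d) ℝ
  /-- initial estimate of the second step -/
  theta₀ : Ω → Fin d → ℝ
  /-- initial gain matrix of the second step -/
  P₀ : Ω → Matrix (Fin d) (Fin d) ℝ

namespace Model

variable {Ω : Type*} {d : ℕ} (m : Model Ω d)

/-- The saturation function `S_k`. -/
def S (k : ℕ) (ω : Ω) (x : ℝ) : ℝ :=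
  sat (m.l k ω) (m.u k ω) (m.L k ω) (m.U k ω) x

/-- `m.obs k` is the observation `y_{k+1} = S_k(φ_kᵀ θ + ε_{k+1})`. -/
def obs (k : ℕ) (ω : Ω) : ℝ :=
  m.S k ω (m.φ k ω ⬝ᵥ m.θ + m.ε (k + 1) ω)

/-- The corrected sign innovation at time `k + 1`, for the current estimate `t`. -/
def innov (k : ℕ) (ω : Ω) (t : Fin d → ℝ) : ℝ :=
  Real.sign (m.obs k ω - m.S k ω (m.φ k ω ⬝ᵥ t))
    + (if m.S k ω (m.φ k ω ⬝ᵥ t) = m.U k ω then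
        m.F (k + 1) ω (m.u k ω - m.φ k ω ⬝ᵥ t) else 0)
    - (if m.S k ω (m.φ k ω ⬝ᵥ t) = m.L k ω then
        1 - m.F (k + 1) ω (m.l k ω - m.φ k ω ⬝ᵥ t) else 0)

/-- The scalar `a_k = 1 / (μ_k + β_k b_k² φ_kᵀ P_k φ_k)`, for given `μ_k`, `β_k` and `P_k`. -/
def gain (k : ℕ) (ω : Ω) (muk betak : ℝ) (P : Matrix (Fin d) (Fin d) ℝ) : ℝ :=
  1 / (muk + betak * m.b k ω ^ 2 * (m.φ k ω ⬝ᵥ (P *ᵥ m.φ k ω)))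

/-- One recursion `(θ_k, P_k) ↦ (θ_{k+1}, P_{k+1})`, for given `μ_k` and `β_k`:
`P_{k+1} = P_k - a_k β_k b_k² P_k φ_k φ_kᵀ P_k` and
`θ_{k+1} = Π_{P_{k+1}⁻¹} (θ_k + a_k b_k P_k φ_k v_{k+1})`. -/
def step (k : ℕ) (ω : Ω) (muk betak : ℝ)
    (s : (Fin d → ℝ) × Matrix (Fin d) (Fin d) ℝ) :
    (Fin d → ℝ) × Matrix (Fin d) (Fin d) ℝ :=
  let a := m.gain k ω muk betak s.2
  let P' := s.2 - (a * betak * m.b k ω ^ 2) •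
    (s.2 * Matrix.vecMulVec (m.φ k ω) (m.φ k ω) * s.2)
  (proj m.D P'⁻¹ (s.1 + (a * m.b k ω * m.innov k ω s.1) • (s.2 *ᵥ m.φ k ω)), P')

/-- The gain `β̄_k` of the first step: the infimum of `f_{k+1}` over
`|x| ≤ max {2 C_k, C_k + l_k, C_k - u_k}`. -/
def betaBar (k : ℕ) (ω : Ω) : ℝ :=
  sInf (m.f (k + 1) ω '' {x : ℝ |
    |x| ≤ max (2 * m.C k ω) (max (m.C k ω + m.l k ω) (m.C k ω - m.u k ω))})

/-- First step of the algorithm: the pairs `(θ̄_k, P̄_k)`. -/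
def prelim (ω : Ω) : ℕ → (Fin d → ℝ) × Matrix (Fin d) (Fin d) ℝ
  | 0 => (m.thetaBar₀ ω, m.PBar₀ ω)
  | k + 1 => m.step k ω (m.muBar k ω) (m.betaBar k ω) (prelim ω k)

/-- The preliminary estimate `θ̄_k`. -/
def thetaBar (k : ℕ) (ω : Ω) : Fin d → ℝ := (m.prelim ω k).1

/-- The gain `β_k` of the second step, when the current accelerated estimate is `t`;
here `e = d_k = φ_kᵀ (θ̄_k - θ_k)`. The last branch is the case `L_k < S_k(φ_kᵀ θ_k) < U_k`. -/
def beta (k : ℕ) (ω : Ω) (t : Fin d → ℝ) : ℝ :=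
  let p := m.φ k ω ⬝ᵥ t
  let q := m.φ k ω ⬝ᵥ m.thetaBar k ω
  let e := m.φ k ω ⬝ᵥ (m.thetaBar k ω - t)
  let G := m.F (k + 1) ω
  let g := m.f (k + 1) ω
  if m.S k ω p = m.L k ω then
    if e ≠ 0 then (G (m.l k ω - p) - G (m.l k ω - q)) / e else g (m.l k ω - p)
  else if m.S k ω p = m.U k ω then
    if e ≠ 0 then (G (m.u k ω - p) - G (m.u k ω - q)) / e else g (m.u k ω - p)
  else
    if e ≠ 0 then (1 - 2 * G (p - q)) / e else 2 * g 0

/-- Second step of the algorithm: the pairs `(θ_k, P_k)`. -/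
def accel (ω : Ω) : ℕ → (Fin d → ℝ) × Matrix (Fin d) (Fin d) ℝ
  | 0 => (m.theta₀ ω, m.P₀ ω)
  | k + 1 => m.step k ω (m.mu k ω) (m.beta k ω (accel ω k).1) (accel ω k)

/-- The accelerated estimate `θ_k`. -/
def theta (k : ℕ) (ω : Ω) : Fin d → ℝ := (m.accel ω k).1

/-- The regret `R_k = b_k |S_k(φ_kᵀ θ) - S_k(φ_kᵀ θ_k)|`. -/
def regret (k : ℕ) (ω : Ω) : ℝ :=
  m.b k ω * |m.S k ω (m.φ k ω ⬝ᵥ m.θ) - m.S k ω (m.φ k ω ⬝ᵥ m.theta k ω)|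

/-- `λ_max(n)`, the largest eigenvalue of `P₀⁻¹ + ∑_{i=0}^n φ_i φ_iᵀ`. -/
def infoMax (n : ℕ) (ω : Ω) : ℝ :=
  lambdaMax ((m.P₀ ω)⁻¹ +
    ∑ i ∈ Finset.range (n + 1), Matrix.vecMulVec (m.φ i ω) (m.φ i ω))

/-- The regressors are adapted and bounded in `k`, `θ` is an interior point of the convex compact
set `D`, and `C_k` is an adapted (known at time `k`) bound of `|φ_kᵀ x|` over `x ∈ D`. -/
structure RegressorAssumption [mΩ : MeasurableSpace Ω] (ℱ : Filtration ℕ mΩ) (ℙ : Measure Ω) :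
    Prop where
  measurable_φ : ∀ k, Measurable[ℱ k] (m.φ k)
  bounded_φ : ∀ᵐ ω ∂ℙ, ∃ B : ℝ, ∀ k, ‖m.φ k ω‖ ≤ B
  convex_D : Convex ℝ m.D
  compact_D : IsCompact m.D
  θ_mem : m.θ ∈ interior m.D
  measurable_C : ∀ k, Measurable[ℱ k] (m.C k)
  le_C : ∀ᵐ ω ∂ℙ, ∀ k, ∀ x ∈ m.D, |m.φ k ω ⬝ᵥ x| ≤ m.C k ω

/-- Assumptions on the thresholds and on the weights; `M` bounds `l_k` and `-u_k` from above. -/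
structure ThresholdAssumption [mΩ : MeasurableSpace Ω] (ℱ : Filtration ℕ mΩ) (ℙ : Measure Ω)
    (M : ℝ) : Prop where
  measurable_l : ∀ k, Measurable[ℱ k] (m.l k)
  measurable_u : ∀ k, Measurable[ℱ k] (m.u k)
  measurable_L : ∀ k, Measurable[ℱ k] (m.L k)
  measurable_U : ∀ k, Measurable[ℱ k] (m.U k)
  ordered : ∀ᵐ ω ∂ℙ, ∀ k, m.L k ω ≤ m.l k ω ∧ m.l k ω ≤ m.u k ω ∧ m.u k ω ≤ m.U k ω
  M_pos : 0 < M
  le_M : ∀ᵐ ω ∂ℙ, ∀ k, max (m.l k ω) (-m.u k ω) ≤ M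
  nondegenerate : ∀ᵐ ω ∂ℙ, ∀ k,
    ¬ (m.L k ω = m.l k ω ∧ m.l k ω = m.u k ω ∧ m.u k ω = m.U k ω)
  measurable_b : ∀ k, Measurable[ℱ k] (m.b k)
  b_bounds : ∀ᵐ ω ∂ℙ, (∃ c : ℝ, 0 < c ∧ ∀ k, c ≤ m.b k ω) ∧ ∀ k, m.b k ω ≤ 1

/-- Assumptions on the noise: given `ℱ k`, the noise `ε_{k+1}` has conditional distribution
function `F_{k+1}` with `F_{k+1}(0) = 1/2` and continuous conditional density `f_{k+1}`, and the
densities are bounded away from `0` and `∞` on `|x| ≤ max {2C, C + M}`, uniformly in `k`, where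
the constant `C` bounds all `C_k`. The observation `y_{k+1}` belongs to the information at
time `k + 1`. -/
structure NoiseAssumption [mΩ : MeasurableSpace Ω] (ℱ : Filtration ℕ mΩ) (ℙ : Measure Ω)
    (M : ℝ) : Prop where
  measurable_ε : ∀ k, Measurable (m.ε (k + 1))
  measurable_obs : ∀ k, Measurable[ℱ (k + 1)] (m.obs k)
  measurable_F : ∀ k x, Measurable[ℱ k] fun ω => m.F (k + 1) ω x
  measurable_f : ∀ k x, Measurable[ℱ k] fun ω => m.f (k + 1) ω x
  condCDF : ∀ k x, (fun ω => m.F (k + 1) ω x) =ᵐ[ℙ]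
    ℙ[Set.indicator {ω | m.ε (k + 1) ω ≤ x} (fun _ => (1 : ℝ)) | ℱ k]
  density : ∀ᵐ ω ∂ℙ, ∀ k, Continuous (m.f (k + 1) ω) ∧ (∀ x, 0 ≤ m.f (k + 1) ω x) ∧
    Integrable (m.f (k + 1) ω) ∧ ∀ x, m.F (k + 1) ω x = ∫ t in Set.Iic x, m.f (k + 1) ω t
  median : ∀ᵐ ω ∂ℙ, ∀ k, m.F (k + 1) ω 0 = 1 / 2
  density_bounds : ∃ C : ℝ, (∀ᵐ ω ∂ℙ, ∀ k, m.C k ω ≤ C) ∧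
    ∀ᵐ ω ∂ℙ, ∃ c₁ c₂ : ℝ, 0 < c₁ ∧ ∀ k x, |x| ≤ max (2 * C) (C + M) →
      c₁ ≤ m.f (k + 1) ω x ∧ m.f (k + 1) ω x ≤ c₂

/-- Admissible tuning of the algorithm: adapted step-size factors bounded away from `0` and `∞`,
and initial values, known at time `0`, with `θ̄_0, θ_0 ∈ D` and `P̄_0, P_0` positive definite. -/
structure Tuning [mΩ : MeasurableSpace Ω] (ℱ : Filtration ℕ mΩ) (ℙ : Measure Ω) : Prop where
  measurable_muBar : ∀ k, Measurable[ℱ k] (m.muBar k)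
  muBar_bounds : ∀ᵐ ω ∂ℙ, ∃ c₁ c₂ : ℝ, 0 < c₁ ∧ ∀ k, c₁ ≤ m.muBar k ω ∧ m.muBar k ω ≤ c₂
  measurable_mu : ∀ k, Measurable[ℱ k] (m.mu k)
  mu_bounds : ∀ᵐ ω ∂ℙ, ∃ c₁ c₂ : ℝ, 0 < c₁ ∧ ∀ k, c₁ ≤ m.mu k ω ∧ m.mu k ω ≤ c₂
  measurable_thetaBar₀ : Measurable[ℱ 0] m.thetaBar₀
  thetaBar₀_mem : ∀ᵐ ω ∂ℙ, m.thetaBar₀ ω ∈ m.D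
  measurable_PBar₀ : ∀ i j, Measurable[ℱ 0] fun ω => m.PBar₀ ω i j
  PBar₀_posDef : ∀ᵐ ω ∂ℙ, (m.PBar₀ ω).PosDef
  measurable_theta₀ : Measurable[ℱ 0] m.theta₀
  theta₀_mem : ∀ᵐ ω ∂ℙ, m.theta₀ ω ∈ m.D
  measurable_P₀ : ∀ i j, Measurable[ℱ 0] fun ω => m.P₀ ω i j
  P₀_posDef : ∀ᵐ ω ∂ℙ, (m.P₀ ω).PosDef

end Model

end TSWLAD

end

/-! Write δ_k = φ_kᵀ(θ - θ_k). A continuous saturation is 1-Lipschitz and b_k ≤ 1, so R_k ≤ |δ_k|;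
by Cauchy-Schwarz it is enough that ∑_{k ≤ n} δ_k² = O(log λ_max(n)).

The Lyapunov function is V_k = (θ - θ_k)ᵀ P_k⁻¹ (θ - θ_k). By Sherman-Morrison P_{k+1}⁻¹ = P_k⁻¹ +
(β_k b_k²/μ_k) φ_k φ_kᵀ, and projecting onto D in the P_{k+1}⁻¹-norm does not increase the distance
to θ. Hence (`energy_step`) V_{k+1} is at most V_k + (β b²/μ) δ² - 2 (b/μ) v δ plus a bounded
multiple of the increment of log det P⁻¹. Almost surely the innovation v is its conditional mean ψ
plus a bounded martingale difference (`innov_eq`). Three facts close the estimate.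

Drift: 2ψδ - bβδ² ≥ κδ² - Kq². For the preliminary recursion β̄ bounds the noise density from below
and q = 0 (`prelim_drift`). For the accelerated one β is the slope that the conditional mean would
have if θ̄_k were the true parameter, and q = φᵀ(θ - θ̄_k) is the price of that substitution
(`accel_drift`).

Noise: a martingale transform is at most any positive multiple of the sum of its squared
coefficients plus a random constant (`ae_sum_mul_le`), so the drift absorbs it.

Growth: log det P_{n+1}⁻¹ ≤ d log λ_max(n) + const (`GoodPath.log_det_le`).

The summation `sum_sq_le_of_energy` is used twice: for the preliminary recursion it gives ∑ q² =
O(log λ_max), and with this the accelerated recursion obeys the same bound. Only prediction errors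
are estimated, never θ - θ_k itself, so no excitation is needed. Many hypotheses hold only almost
surely, so the estimates are shown to be adapted to the completed σ-algebras. -/

namespace TSWLAD

/-! ### Quadratic forms and rank-one updates -/

section Matrices

variable {d : ℕ}

theorem dotProduct_mulVec_comm {Q : Matrix (Fin d) (Fin d) ℝ} (hQ : Q.IsHermitian)
    (x y : Fin d → ℝ) : x ⬝ᵥ (Q *ᵥ y) = y ⬝ᵥ (Q *ᵥ x) := by
  have hT : Qᵀ = Q := by simpa [conjTranspose_eq_transpose_of_trivial] using hQ.eq
  rw [dotProduct_mulVec, ← mulVec_transpose, hT, dotProduct_comm]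

theorem dotProduct_mulVec_self_add {Q : Matrix (Fin d) (Fin d) ℝ} (hQ : Q.IsHermitian)
    (x y : Fin d → ℝ) : (x + y) ⬝ᵥ (Q *ᵥ (x + y)) =
      x ⬝ᵥ (Q *ᵥ x) + 2 * (x ⬝ᵥ (Q *ᵥ y)) + y ⬝ᵥ (Q *ᵥ y) := by
  rw [mulVec_add, add_dotProduct, dotProduct_add, dotProduct_add, dotProduct_mulVec_comm hQ y x]
  ring

theorem PosDef.dotProduct_mulVec_self_nonneg {Q : Matrix (Fin d) (Fin d) ℝ} (hQ : Q.PosDef)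
    (x : Fin d → ℝ) : 0 ≤ x ⬝ᵥ (Q *ᵥ x) := by
  simpa using hQ.posSemidef.dotProduct_mulVec_nonneg x

theorem vecMulVec_self_mulVec (φ x : Fin d → ℝ) :
    vecMulVec φ φ *ᵥ x = (φ ⬝ᵥ x) • φ := by
  ext i
  simp [vecMulVec, mulVec, dotProduct, Finset.sum_mul]
  exact Finset.sum_congr rfl fun j _ => by ring

theorem posSemidef_vecMulVec_self (φ : Fin d → ℝ) : (vecMulVec φ φ).PosSemidef := by
  simpa using posSemidef_vecMulVec_self_star φ

theorem vecMulVec_mul_mul_vecMulVec (φ : Fin d → ℝ) (P : Matrix (Fin d) (Fin d) ℝ) :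
    vecMulVec φ φ * P * vecMulVec φ φ = (φ ⬝ᵥ (P *ᵥ φ)) • vecMulVec φ φ := by
  rw [vecMulVec_mul, vecMulVec_mul_vecMulVec, ← dotProduct_mulVec, vecMulVec_smul]

/-- Sherman-Morrison formula for a symmetric rank one update. -/
theorem inv_sub_smul_rank_one {P : Matrix (Fin d) (Fin d) ℝ} (hP : P.PosDef) {r c : ℝ}
    (φ : Fin d → ℝ) (hc : c * (1 + r * (φ ⬝ᵥ (P *ᵥ φ))) = r) :
    (P - c • (P * vecMulVec φ φ * P))⁻¹ = P⁻¹ + r • vecMulVec φ φ := by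
  apply inv_eq_right_inv
  have hdet : IsUnit P.det := (isUnit_iff_isUnit_det P).1 hP.isUnit
  have h1 : P * vecMulVec φ φ * P * P⁻¹ = P * vecMulVec φ φ := by
    rw [Matrix.mul_assoc, mul_nonsing_inv P hdet, Matrix.mul_one]
  have h2 : P * vecMulVec φ φ * P * vecMulVec φ φ =
      (φ ⬝ᵥ (P *ᵥ φ)) • (P * vecMulVec φ φ) := by
    rw [Matrix.mul_assoc, Matrix.mul_assoc, ← Matrix.mul_assoc (vecMulVec φ φ),
      vecMulVec_mul_mul_vecMulVec, Matrix.mul_smul]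
  rw [Matrix.sub_mul, Matrix.mul_add, Matrix.mul_add, mul_nonsing_inv P hdet, Matrix.mul_smul,
    Matrix.smul_mul, Matrix.smul_mul, h1, Matrix.mul_smul, h2, smul_smul, smul_smul, add_sub_assoc,
    ← add_smul, ← sub_smul]
  rw [show r - (c + c * r * (φ ⬝ᵥ (P *ᵥ φ))) = 0 by linear_combination -hc]
  simp

/-- Matrix determinant lemma: each update of the inverse gain adds one explicit term to log det. -/
theorem det_add_smul_rank_one {P : Matrix (Fin d) (Fin d) ℝ} (hP : P.PosDef) (r : ℝ)
    (φ : Fin d → ℝ) :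
    (P⁻¹ + r • vecMulVec φ φ).det = P⁻¹.det * (1 + r * (φ ⬝ᵥ (P *ᵥ φ))) := by
  have hdet : IsUnit P.det := (isUnit_iff_isUnit_det P).1 hP.isUnit
  have hdet' : IsUnit P⁻¹.det := (isUnit_iff_isUnit_det _).1 hP.inv.isUnit
  rw [← smul_vecMulVec, vecMulVec_eq Unit, det_add_replicateCol_mul_replicateRow hdet',
    nonsing_inv_nonsing_inv P hdet]
  congr 2
  rw [Matrix.mul_assoc, ← replicateCol_mulVec]
  simp [Matrix.det_unique, replicateRow_mul_replicateCol_apply, mulVec_smul]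

theorem one_sub_inv_le_log {x : ℝ} (hx : 0 < x) : 1 - 1 / x ≤ Real.log x := by
  simpa using Real.one_sub_inv_le_log_of_pos hx

end Matrices

/-! ### Weighted projection onto a compact convex set -/

section Projection

variable {d : ℕ} {D : Set (Fin d → ℝ)} {Q : Matrix (Fin d) (Fin d) ℝ}

theorem continuous_qnorm_sub :
    Continuous fun a : Matrix (Fin d) (Fin d) ℝ × (Fin d → ℝ) × (Fin d → ℝ) =>
      qnorm a.1 (a.2.1 - a.2.2) := by
  unfold qnorm
  exact Real.continuous_sqrt.comp (Continuous.dotProduct (by fun_prop)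
    (Continuous.matrix_mulVec (by fun_prop) (by fun_prop)))

/-- Compactness supplies a minimizer, so the choice in `proj` is a genuine one; uniqueness is not
needed for this. -/
theorem proj_spec (hD : IsCompact D) (hne : D.Nonempty) (Q : Matrix (Fin d) (Fin d) ℝ)
    (x : Fin d → ℝ) :
    proj D Q x ∈ D ∧ ∀ z ∈ D, qnorm Q (x - proj D Q x) ≤ qnorm Q (x - z) := by
  have hc : ContinuousOn (fun y => qnorm Q (x - y)) D :=
    (continuous_qnorm_sub.comp (f := fun y => (Q, x, y)) (by fun_prop)).continuousOn
  obtain ⟨y, hy, hmin⟩ := hD.exists_isMinOn hne hc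
  exact Classical.epsilon_spec (p := fun y => y ∈ D ∧ ∀ z ∈ D, qnorm Q (x - y) ≤ qnorm Q (x - z))
    ⟨y, hy, fun z hz => hmin hz⟩

/-- Obtuse-angle criterion: at the minimizer, x - y has nonpositive Q-product with every direction z
- y into D. Expanding the square of (x - y) - (z - y) then gives the inequality. -/
theorem sq_dist_add_le_of_isMin (hQ : Q.PosDef) (hconv : Convex ℝ D) {x y z : Fin d → ℝ}
    (hy : y ∈ D) (hmin : ∀ z ∈ D, qnorm Q (x - y) ≤ qnorm Q (x - z)) (hz : z ∈ D) :
    (z - y) ⬝ᵥ (Q *ᵥ (z - y)) + (x - y) ⬝ᵥ (Q *ᵥ (x - y)) ≤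
      (x - z) ⬝ᵥ (Q *ᵥ (x - z)) := by
  set e := z - y with he
  set g := x - y with hg
  have hin : g ⬝ᵥ (Q *ᵥ e) ≤ 0 := by
    by_contra! hpos
    set B := e ⬝ᵥ (Q *ᵥ e)
    have hB : 0 ≤ B := PosDef.dotProduct_mulVec_self_nonneg hQ e
    -- Minimality against the point y + s(z - y) of D, divided by s. A value of s with sB at most
    -- the positive product of g and e is then contradictory.
    have key : ∀ s : ℝ, 0 < s → s ≤ 1 → 2 * (g ⬝ᵥ (Q *ᵥ e)) ≤ s * B := by
      intro s hs hs1
      have hmem : y + s • e ∈ D := hconv.add_smul_sub_mem hy hz ⟨hs.le, hs1⟩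
      have h := hmin _ hmem
      unfold qnorm at h
      rw [Real.sqrt_le_sqrt_iff (PosDef.dotProduct_mulVec_self_nonneg hQ _)] at h
      have h2 : x - (y + s • e) = g + (-s) • e := by rw [hg, neg_smul]; abel
      rw [h2, dotProduct_mulVec_self_add hQ.1] at h
      simp only [mulVec_smul, dotProduct_smul, smul_dotProduct, smul_eq_mul] at h
      have : s * (2 * (g ⬝ᵥ (Q *ᵥ e))) ≤ s * (s * B) := by
        change _ ≤ _ + _ + -s * (-s * B) at h
        linarith
      exact le_of_mul_le_mul_left this hs
    have h1 := key (min 1 ((g ⬝ᵥ (Q *ᵥ e)) / (B + 1))) (by positivity) (min_le_left _ _)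
    have h2 : min 1 ((g ⬝ᵥ (Q *ᵥ e)) / (B + 1)) * B ≤ (g ⬝ᵥ (Q *ᵥ e)) / (B + 1) * (B + 1) :=
      mul_le_mul (min_le_right _ _) (by linarith) hB (by positivity)
    rw [div_mul_cancel₀ _ (by positivity)] at h2
    linarith
  have h2 : x - z = g + (-1 : ℝ) • e := by rw [hg, he, neg_one_smul]; abel
  rw [h2, dotProduct_mulVec_self_add hQ.1]
  simp only [mulVec_smul, dotProduct_smul, smul_dotProduct, smul_eq_mul]
  linarith

theorem eq_of_isMin (hQ : Q.PosDef) (hconv : Convex ℝ D) {x y z : Fin d → ℝ}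
    (hy : y ∈ D) (hmin : ∀ z ∈ D, qnorm Q (x - y) ≤ qnorm Q (x - z))
    (hz : z ∈ D) (hmin' : ∀ y ∈ D, qnorm Q (x - z) ≤ qnorm Q (x - y)) : z = y := by
  have h1 := sq_dist_add_le_of_isMin hQ hconv hy hmin hz
  have h2 := hmin' y hy
  unfold qnorm at h2
  rw [Real.sqrt_le_sqrt_iff (PosDef.dotProduct_mulVec_self_nonneg hQ _)] at h2
  by_contra hne
  have := hQ.dotProduct_mulVec_pos (sub_ne_zero.2 hne)
  simp only [star_trivial] at this
  linarith

/-- Closed-graph argument: projections stay in the compact D, a cluster point of minimizers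
minimizes because the inequality is closed, and the minimizer is unique. Continuity serves to make
the projected estimates measurable. -/
theorem continuous_proj_posDef (hD : IsCompact D) (hne : D.Nonempty) (hconv : Convex ℝ D) :
    Continuous fun a : {Q : Matrix (Fin d) (Fin d) ℝ // Q.PosDef} × (Fin d → ℝ) =>
      proj D a.1.1 a.2 := by
  rw [continuous_iff_continuousAt]
  rintro ⟨⟨Q, hQ⟩, x⟩
  refine hD.tendsto_nhds_of_unique_mapClusterPt
    (Eventually.of_forall fun a => (proj_spec hD hne a.1.1 a.2).1) ?_
  intro y hy hcl
  refine eq_of_isMin hQ hconv (proj_spec hD hne Q x).1 (proj_spec hD hne Q x).2 hy ?_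
  intro z hz
  set f := fun a : {Q : Matrix (Fin d) (Fin d) ℝ // Q.PosDef} × (Fin d → ℝ) => proj D a.1.1 a.2
  have hcl2 : MapClusterPt ((⟨⟨Q, hQ⟩, x⟩ : {Q : Matrix (Fin d) (Fin d) ℝ // Q.PosDef} ×
      (Fin d → ℝ)), y) (nhds (⟨⟨Q, hQ⟩, x⟩ : {Q : Matrix (Fin d) (Fin d) ℝ // Q.PosDef} ×
      (Fin d → ℝ))) (fun a => (a, f a)) := by
    rw [mapClusterPt_iff_ultrafilter] at hcl ⊢
    obtain ⟨u, hu, huy⟩ := hcl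
    exact ⟨u, hu, (tendsto_id.mono_left hu).prodMk_nhds huy⟩
  have hclosed : IsClosed {p : ({Q : Matrix (Fin d) (Fin d) ℝ // Q.PosDef} × (Fin d → ℝ)) ×
      (Fin d → ℝ) | qnorm p.1.1.1 (p.1.2 - p.2) ≤ qnorm p.1.1.1 (p.1.2 - z)} := by
    refine isClosed_le ?_ ?_
    · exact continuous_qnorm_sub.comp (f := fun p : ({Q : Matrix (Fin d) (Fin d) ℝ // Q.PosDef} ×
        (Fin d → ℝ)) × (Fin d → ℝ) => (p.1.1.1, p.1.2, p.2)) (by fun_prop)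
    · exact continuous_qnorm_sub.comp (f := fun p : ({Q : Matrix (Fin d) (Fin d) ℝ // Q.PosDef} ×
        (Fin d → ℝ)) × (Fin d → ℝ) => (p.1.1.1, p.1.2, z)) (by fun_prop)
  rw [mapClusterPt_iff_ultrafilter] at hcl2
  obtain ⟨u, -, hu⟩ := hcl2
  exact hclosed.mem_of_tendsto hu
    (Eventually.of_forall fun a => (proj_spec hD hne a.1.1 a.2).2 z hz)

end Projection

/-! ### One-step energy inequality -/

section Energy

variable {d : ℕ} {D : Set (Fin d → ℝ)}

/-- The gain matrix after one recursion. -/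
noncomputable def gainUpdate (P : Matrix (Fin d) (Fin d) ℝ) (φ : Fin d → ℝ) (μ β b : ℝ) :
    Matrix (Fin d) (Fin d) ℝ :=
  P - (1 / (μ + β * b ^ 2 * (φ ⬝ᵥ (P *ᵥ φ))) * β * b ^ 2) • (P * vecMulVec φ φ * P)

theorem inv_gainUpdate {P : Matrix (Fin d) (Fin d) ℝ} (hP : P.PosDef) (φ : Fin d → ℝ)
    {μ β : ℝ} (b : ℝ) (hμ : 0 < μ) (hβ : 0 < β) :
    (gainUpdate P φ μ β b)⁻¹ = P⁻¹ + (β * b ^ 2 / μ) • vecMulVec φ φ := by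
  have hs := PosDef.dotProduct_mulVec_self_nonneg hP φ
  refine inv_sub_smul_rank_one hP φ ?_
  have : 0 < μ + β * b ^ 2 * (φ ⬝ᵥ (P *ᵥ φ)) := by positivity
  field_simp

theorem posDef_gainUpdate {P : Matrix (Fin d) (Fin d) ℝ} (hP : P.PosDef) (φ : Fin d → ℝ)
    {μ β : ℝ} (b : ℝ) (hμ : 0 < μ) (hβ : 0 < β) : (gainUpdate P φ μ β b).PosDef := by
  rw [← posDef_inv_iff, inv_gainUpdate hP φ b hμ hβ]
  exact hP.inv.add_posSemidef ((posSemidef_vecMulVec_self φ).smul (by positivity))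

/-- The step direction is rewritten with the new gain, so that the weight P_{k+1}⁻¹ of the new
energy cancels against it. -/
theorem smul_mulVec_eq_gainUpdate_mulVec {P : Matrix (Fin d) (Fin d) ℝ} (hP : P.PosDef)
    (φ : Fin d → ℝ) {μ β : ℝ} (b : ℝ) (hμ : 0 < μ) (hβ : 0 < β) :
    (1 / (μ + β * b ^ 2 * (φ ⬝ᵥ (P *ᵥ φ)))) • (P *ᵥ φ) =
      (1 / μ) • (gainUpdate P φ μ β b *ᵥ φ) := by
  have hs := PosDef.dotProduct_mulVec_self_nonneg hP φ
  have hpos : 0 < μ + β * b ^ 2 * (φ ⬝ᵥ (P *ᵥ φ)) := by positivity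
  rw [gainUpdate, Matrix.sub_mulVec, smul_mulVec, ← mulVec_mulVec, ← mulVec_mulVec,
    vecMulVec_self_mulVec, mulVec_smul, smul_smul, smul_sub, smul_smul, ← sub_smul]
  congr 1
  field_simp
  ring

/-- With x = 1 + (βb²/μ) φᵀPφ the left side is 1 - 1/x and the right side is log x. Over time the
right sides telescope. -/
theorem dotProduct_gainUpdate_mulVec_le {P : Matrix (Fin d) (Fin d) ℝ} (hP : P.PosDef)
    (φ : Fin d → ℝ) {μ β : ℝ} (b : ℝ) (hμ : 0 < μ) (hβ : 0 < β) :
    β * b ^ 2 / μ * (φ ⬝ᵥ (gainUpdate P φ μ β b *ᵥ φ)) ≤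
      Real.log (gainUpdate P φ μ β b)⁻¹.det - Real.log P⁻¹.det := by
  have hs := PosDef.dotProduct_mulVec_self_nonneg hP φ
  have hpos : 0 < μ + β * b ^ 2 * (φ ⬝ᵥ (P *ᵥ φ)) := by positivity
  have h1 : φ ⬝ᵥ (gainUpdate P φ μ β b *ᵥ φ) =
      μ / (μ + β * b ^ 2 * (φ ⬝ᵥ (P *ᵥ φ))) * (φ ⬝ᵥ (P *ᵥ φ)) := by
    have := congrArg (fun x => μ * (φ ⬝ᵥ x)) (smul_mulVec_eq_gainUpdate_mulVec hP φ b hμ hβ)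
    simp only [dotProduct_smul, smul_eq_mul] at this
    rw [← mul_assoc, ← mul_assoc, mul_one_div, mul_one_div_cancel hμ.ne', one_mul] at this
    exact this.symm
  have hpos' : 0 < 1 + β * b ^ 2 / μ * (φ ⬝ᵥ (P *ᵥ φ)) := by positivity
  rw [inv_gainUpdate hP φ b hμ hβ, det_add_smul_rank_one hP,
    Real.log_mul hP.inv.det_pos.ne' hpos'.ne', add_sub_cancel_left, h1]
  refine le_trans (le_of_eq ?_) (one_sub_inv_le_log hpos')
  have : 1 + β * b ^ 2 / μ * (φ ⬝ᵥ (P *ᵥ φ)) =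
      (μ + β * b ^ 2 * (φ ⬝ᵥ (P *ᵥ φ))) / μ := by field_simp
  rw [this]
  field_simp
  ring

theorem log_det_inv_gainUpdate_ge {P : Matrix (Fin d) (Fin d) ℝ} (hP : P.PosDef)
    (φ : Fin d → ℝ) {μ β : ℝ} (b : ℝ) (hμ : 0 < μ) (hβ : 0 < β) :
    Real.log P⁻¹.det ≤ Real.log (gainUpdate P φ μ β b)⁻¹.det := by
  have h := dotProduct_gainUpdate_mulVec_le hP φ b hμ hβ
  have h2 := PosDef.dotProduct_mulVec_self_nonneg (posDef_gainUpdate hP φ b hμ hβ) φ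
  have : 0 ≤ β * b ^ 2 / μ * (φ ⬝ᵥ (gainUpdate P φ μ β b *ᵥ φ)) := by positivity
  linarith

/-- The decrease of the weighted squared error in one projected recursion. -/
theorem energy_step (hD : IsCompact D) (hconv : Convex ℝ D) {θ : Fin d → ℝ} (hθ : θ ∈ D)
    {P : Matrix (Fin d) (Fin d) ℝ} (hP : P.PosDef) (φ t : Fin d → ℝ)
    {μ β : ℝ} (b v : ℝ) (hμ : 0 < μ) (hβ : 0 < β) {t' : Fin d → ℝ}
    (ht' : t' = proj D (gainUpdate P φ μ β b)⁻¹
      (t + (1 / (μ + β * b ^ 2 * (φ ⬝ᵥ (P *ᵥ φ))) * b * v) • (P *ᵥ φ))) :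
    (θ - t') ⬝ᵥ ((gainUpdate P φ μ β b)⁻¹ *ᵥ (θ - t')) ≤
      (θ - t) ⬝ᵥ (P⁻¹ *ᵥ (θ - t)) + β * b ^ 2 / μ * (φ ⬝ᵥ (θ - t)) ^ 2
        - 2 * (b / μ) * v * (φ ⬝ᵥ (θ - t))
        + v ^ 2 / (β * μ) * (Real.log (gainUpdate P φ μ β b)⁻¹.det - Real.log P⁻¹.det) := by
  set P' := gainUpdate P φ μ β b with hP'
  have hP'pd : P'.PosDef := posDef_gainUpdate hP φ b hμ hβ
  set x := t + (1 / (μ + β * b ^ 2 * (φ ⬝ᵥ (P *ᵥ φ))) * b * v) • (P *ᵥ φ) with hx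
  obtain ⟨hmem, hmin⟩ := proj_spec hD ⟨θ, hθ⟩ P'⁻¹ x
  rw [← ht'] at hmem hmin
  have h1 := sq_dist_add_le_of_isMin hP'pd.inv hconv hmem hmin hθ
  have h2 := PosDef.dotProduct_mulVec_self_nonneg hP'pd.inv (x - t')
  have hxθ : x - θ = (-1 : ℝ) • (θ - t) + (b * v / μ) • (P' *ᵥ φ) := by
    have hxt : (1 / (μ + β * b ^ 2 * (φ ⬝ᵥ (P *ᵥ φ))) * b * v) • (P *ᵥ φ) =
        (b * v / μ) • (P' *ᵥ φ) := by
      have := congrArg (fun y => (b * v) • y) (smul_mulVec_eq_gainUpdate_mulVec hP φ b hμ hβ)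
      simp only [smul_smul] at this
      rw [hP', div_eq_mul_one_div (b * v), ← this]
      congr 1
      ring
    rw [hx, hxt, neg_one_smul]
    abel
  have hdet' : IsUnit P'.det := (isUnit_iff_isUnit_det P').1 hP'pd.isUnit
  have hcancel : P'⁻¹ *ᵥ (P' *ᵥ φ) = φ := by
    rw [mulVec_mulVec, nonsing_inv_mul P' hdet', one_mulVec]
  rw [hxθ, dotProduct_mulVec_self_add hP'pd.inv.1] at h1
  simp only [mulVec_smul, dotProduct_smul, smul_dotProduct, smul_eq_mul, hcancel] at h1
  have h3 : (θ - t) ⬝ᵥ (P'⁻¹ *ᵥ (θ - t)) =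
      (θ - t) ⬝ᵥ (P⁻¹ *ᵥ (θ - t)) + β * b ^ 2 / μ * (φ ⬝ᵥ (θ - t)) ^ 2 := by
    rw [hP', inv_gainUpdate hP φ b hμ hβ, add_mulVec, dotProduct_add, smul_mulVec,
      vecMulVec_self_mulVec, dotProduct_smul, dotProduct_smul, dotProduct_comm (θ - t) φ]
    simp only [smul_eq_mul]
    ring
  have h4 := dotProduct_gainUpdate_mulVec_le hP φ b hμ hβ
  rw [← hP'] at h4
  -- The squared length of the step, factored so that the log-determinant increment bounds the
  -- second factor.
  have h5 : (b * v / μ) * ((b * v / μ) * (P' *ᵥ φ ⬝ᵥ φ)) ≤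
      v ^ 2 / (β * μ) * (Real.log P'⁻¹.det - Real.log P⁻¹.det) := by
    calc (b * v / μ) * ((b * v / μ) * (P' *ᵥ φ ⬝ᵥ φ))
        = v ^ 2 / (β * μ) * (β * b ^ 2 / μ * (φ ⬝ᵥ (P' *ᵥ φ))) := by
          rw [dotProduct_comm (P' *ᵥ φ) φ]
          field_simp
      _ ≤ _ := mul_le_mul_of_nonneg_left h4 (by positivity)
  rw [h3, dotProduct_comm (θ - t) φ] at h1
  have h6 : b * v / μ * (φ ⬝ᵥ (θ - t)) = b / μ * v * (φ ⬝ᵥ (θ - t)) := by ring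
  linarith

end Energy

/-! ### Largest eigenvalue, trace and determinant -/

section LambdaMax

variable {d : ℕ} {A : Matrix (Fin d) (Fin d) ℝ}

theorem setOf_hasEigenvalue_eq_range (hA : A.IsHermitian) :
    {t : ℝ | Module.End.HasEigenvalue (Matrix.toLin' A) t} = Set.range hA.eigenvalues := by
  rw [← hA.spectrum_real_eq_range_eigenvalues]
  ext t
  rw [Set.mem_ofPred_eq, Module.End.hasEigenvalue_iff_mem_spectrum, Matrix.spectrum_toLin']

theorem eigenvalues_le_lambdaMax (hA : A.IsHermitian) (i : Fin d) :
    hA.eigenvalues i ≤ lambdaMax A := by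
  rw [lambdaMax, setOf_hasEigenvalue_eq_range hA]
  exact le_csSup (Set.finite_range _).bddAbove ⟨i, rfl⟩

theorem exists_eigenvector_lambdaMax (hd : 1 ≤ d) (hA : A.IsHermitian) :
    ∃ x : Fin d → ℝ, x ≠ 0 ∧ A *ᵥ x = lambdaMax A • x := by
  -- For d = 0 the spectrum is empty and the supremum is the default value 0, attained by no
  -- eigenvector.
  have : Nonempty (Fin d) := ⟨⟨0, hd⟩⟩
  have hmem : lambdaMax A ∈ {t : ℝ | Module.End.HasEigenvalue (Matrix.toLin' A) t} := by
    rw [lambdaMax, setOf_hasEigenvalue_eq_range hA]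
    exact (Set.range_nonempty _).csSup_mem (Set.finite_range _)
  obtain ⟨x, hx⟩ := Module.End.HasEigenvalue.exists_hasEigenvector hmem
  exact ⟨x, hx.2, by simpa using hx.apply_eq_smul⟩

/-- If t is an eigenvalue of λ_max·1 - A, then λ_max - t is one of A, hence t ≥ 0; so λ_max·1 - A is
positive semidefinite. -/
theorem dotProduct_mulVec_le_lambdaMax (hA : A.IsHermitian) (x : Fin d → ℝ) :
    x ⬝ᵥ (A *ᵥ x) ≤ lambdaMax A * (x ⬝ᵥ x) := by
  have hB : (lambdaMax A • (1 : Matrix (Fin d) (Fin d) ℝ) - A).IsHermitian :=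
    (isHermitian_one.smul (by simp [IsSelfAdjoint])).sub hA
  have hps : (lambdaMax A • (1 : Matrix (Fin d) (Fin d) ℝ) - A).PosSemidef := by
    rw [hB.posSemidef_iff_eigenvalues_nonneg]
    intro i
    have hmem : hB.eigenvalues i ∈
        {t : ℝ | Module.End.HasEigenvalue (Matrix.toLin' (lambdaMax A • 1 - A)) t} := by
      rw [setOf_hasEigenvalue_eq_range hB]; exact ⟨i, rfl⟩
    obtain ⟨y, hy⟩ := Module.End.HasEigenvalue.exists_hasEigenvector hmem
    have hy1 : (lambdaMax A • (1 : Matrix (Fin d) (Fin d) ℝ) - A) *ᵥ y =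
        hB.eigenvalues i • y := by rw [← toLin'_apply]; exact hy.apply_eq_smul
    have hy2 : A *ᵥ y = (lambdaMax A - hB.eigenvalues i) • y := by
      rw [sub_mulVec, smul_mulVec, one_mulVec] at hy1
      rw [sub_smul, ← hy1]; abel
    have : lambdaMax A - hB.eigenvalues i ≤ lambdaMax A := by
      conv_rhs => rw [lambdaMax]
      refine le_csSup ?_ ?_
      · rw [setOf_hasEigenvalue_eq_range hA]; exact (Set.finite_range _).bddAbove
      · exact Module.End.hasEigenvalue_of_hasEigenvector
          (x := y) ⟨Module.End.mem_eigenspace_iff.2 (by simpa using hy2), hy.2⟩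
    simpa using this
  have h := hps.dotProduct_mulVec_nonneg x
  simp only [star_trivial, sub_mulVec, smul_mulVec, one_mulVec, dotProduct_sub,
    dotProduct_smul, smul_eq_mul] at h
  linarith

theorem lambdaMax_le_add (hd : 1 ≤ d) (hA : A.IsHermitian) {B : Matrix (Fin d) (Fin d) ℝ}
    (hB : B.PosSemidef) : lambdaMax A ≤ lambdaMax (A + B) := by
  obtain ⟨x, hx, hAx⟩ := exists_eigenvector_lambdaMax hd hA
  have h1 := dotProduct_mulVec_le_lambdaMax (hA.add hB.1) x
  have h2 := hB.dotProduct_mulVec_nonneg x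
  rw [add_mulVec, dotProduct_add, hAx, dotProduct_smul, smul_eq_mul] at h1
  have h3 : 0 < x ⬝ᵥ x := by simpa using dotProduct_star_self_pos_iff.2 hx
  simp only [star_trivial] at h2
  exact le_of_mul_le_mul_right (by linarith) h3

theorem trace_le_lambdaMax (hA : A.IsHermitian) : A.trace ≤ d * lambdaMax A := by
  rw [hA.trace_eq_sum_eigenvalues]
  simpa using Finset.sum_le_sum fun i (_ : i ∈ Finset.univ) => eigenvalues_le_lambdaMax hA i

/-- Positive eigenvalues are each at most their sum, so the product of d of them is at most the d-th
power of the trace. -/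
theorem log_det_le_log_trace (hA : A.PosDef) :
    Real.log A.det ≤ d * Real.log A.trace := by
  have hdet : A.det ≤ A.trace ^ d := by
    have h1 : A.det = ∏ i, hA.1.eigenvalues i := by simpa using hA.1.det_eq_prod_eigenvalues
    have h2 : A.trace = ∑ i, hA.1.eigenvalues i := by simpa using hA.1.trace_eq_sum_eigenvalues
    rw [h1, h2]
    calc ∏ i, hA.1.eigenvalues i ≤ ∏ _i : Fin d, ∑ j, hA.1.eigenvalues j :=
          Finset.prod_le_prod (fun i _ => (hA.eigenvalues_pos i).le) fun i _ =>
            Finset.single_le_sum (fun j _ => (hA.eigenvalues_pos j).le) (Finset.mem_univ i)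
      _ = _ := by simp
  rw [← Real.log_pow]
  exact Real.log_le_log hA.det_pos hdet

end LambdaMax

end TSWLAD

namespace TSWLAD

/-! ### Measurability up to null sets -/

section Completion

variable {Ω : Type*} {mΩ : MeasurableSpace Ω} {μ : Measure Ω}

/-- The σ-algebra of the sets that agree with a set of `m` up to a `μ`-null set. -/
abbrev completed (m : MeasurableSpace Ω) (μ : Measure[mΩ] Ω) : MeasurableSpace Ω :=
  eventuallyMeasurableSpace m (ae μ)

theorem completed_mono {m₁ m₂ : MeasurableSpace Ω} (h : m₁ ≤ m₂) :
    completed m₁ μ ≤ completed m₂ μ := fun _ ⟨t, ht, hst⟩ => ⟨t, h _ ht, hst⟩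

theorem le_completed (m : MeasurableSpace Ω) (μ : Measure[mΩ] Ω) : m ≤ completed m μ :=
  le_eventuallyMeasurableSpace

theorem _root_.Measurable.congr_completed {m : MeasurableSpace Ω} {β : Type*} [MeasurableSpace β]
    {f g : Ω → β} (hf : Measurable[completed m μ] f) (h : f =ᵐ[μ] g) :
    Measurable[completed m μ] g :=
  EventuallyMeasurable.congr (m := m) (l := ae μ) hf h.symm

/-- Each approximating simple function is corrected on a null set. The limsup of the corrected
functions is m-measurable even where they diverge, and equals f almost everywhere. -/
theorem aestronglyMeasurable_of_measurable_completed {m : MeasurableSpace Ω} {f : Ω → ℝ}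
    (hf : Measurable[completed m μ] f) : AEStronglyMeasurable[m] f μ := by
  have hs : StronglyMeasurable[completed m μ] f := hf.stronglyMeasurable
  obtain ⟨fs, hfs⟩ := hs
  have key : ∀ g : @SimpleFunc Ω (completed m μ) ℝ, AEStronglyMeasurable[m] g μ := by
    intro g
    induction g using SimpleFunc.induction with
    | @const c s hs =>
      obtain ⟨t, ht, hst⟩ := hs
      refine ⟨t.indicator fun _ => c, stronglyMeasurable_const.indicator ht, ?_⟩
      filter_upwards [hst] with ω hω
      have : ω ∈ s ↔ ω ∈ t := hω.to_iff
      by_cases h : ω ∈ t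
      · rw [Set.indicator_of_mem h]
        exact if_pos (this.2 h)
      · rw [Set.indicator_of_notMem h]
        exact if_neg (fun h' => h (this.1 h'))
    | @add f g _ hf hg => exact hf.add hg
  choose g hg hfg using fun n => key (fs n)
  refine ⟨fun ω => limsup (fun n => g n ω) atTop,
    (Measurable.limsup fun n => (hg n).measurable).stronglyMeasurable, ?_⟩
  filter_upwards [ae_all_iff.2 hfg] with ω hω
  simp only [← hω]
  exact (hfs ω).limsup_eq.symm

theorem measurable_comp_of_continuous {Ω : Type*} {_ : MeasurableSpace Ω} {F : Ω → ℝ → ℝ}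
    (hF : ∀ x, Measurable fun ω => F ω x) (hc : ∀ ω, Continuous (F ω)) {X : Ω → ℝ}
    (hX : Measurable X) : Measurable fun ω => F ω (X ω) :=
  (measurable_uncurry_of_continuous_of_measurable (u := fun x ω => F ω x) hc hF).comp
    (hX.prodMk measurable_id)

/-- Joint measurability of a Carathéodory function asks for continuity at every ω; F is replaced by
0 on the exceptional null set, which the completion ignores. -/
theorem measurable_completed_comp_of_continuous {m : MeasurableSpace Ω} {F : Ω → ℝ → ℝ}
    (hF : ∀ x, Measurable[m] fun ω => F ω x) (hc : ∀ᵐ ω ∂μ, Continuous (F ω)) {X : Ω → ℝ}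
    (hX : Measurable[completed m μ] X) : Measurable[completed m μ] fun ω => F ω (X ω) := by
  classical
  set F' : Ω → ℝ → ℝ := fun ω => if Continuous (F ω) then F ω else fun _ => 0 with hF'
  have heq : ∀ᵐ ω ∂μ, F ω = F' ω := by
    filter_upwards [hc] with ω hω
    simp [hF', hω]
  have hF'c : ∀ ω, Continuous (F' ω) := by
    intro ω
    by_cases h : Continuous (F ω)
    · simp [hF', h]
    · simp [hF', h, continuous_const]
  have hF'm : ∀ x, Measurable[completed m μ] fun ω => F' ω x := fun x =>
    ((hF x).mono (le_completed m μ) le_rfl).congr_completed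
      (by filter_upwards [heq] with ω hω; rw [hω])
  have h2 : Measurable[completed m μ] fun ω => F' ω (X ω) :=
    measurable_comp_of_continuous hF'm hF'c hX
  exact h2.congr_completed (by filter_upwards [heq] with ω hω; rw [hω])

end Completion

/-! ### Conditional distribution function at a random point -/

section ConditionalDistribution

variable {Ω : Type*} {m mΩ : MeasurableSpace Ω} {μ : Measure Ω} [IsProbabilityMeasure μ]
  {ε : Ω → ℝ} {F : Ω → ℝ → ℝ}

theorem integrable_of_forall_abs_le {f : Ω → ℝ} (hf : AEStronglyMeasurable f μ) {c : ℝ}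
    (h : ∀ᵐ ω ∂μ, |f ω| ≤ c) : Integrable f μ :=
  Integrable.of_bound hf c h

/-- On the m-measurable event j = i the threshold is the constant c i, where the hypothesis applies;
there are countably many such events. -/
theorem condExp_indicator_le_of_countable_range (hm : m ≤ mΩ) (hε : Measurable ε)
    (hF : ∀ x, (fun ω => F ω x) =ᵐ[μ] μ[Set.indicator {ω | ε ω ≤ x} (fun _ => (1 : ℝ)) | m])
    {j : Ω → ℤ} (hj : Measurable[m] j) (c : ℤ → ℝ) :
    μ[Set.indicator {ω | ε ω ≤ c (j ω)} (fun _ => (1 : ℝ)) | m] =ᵐ[μ] fun ω => F ω (c (j ω)) := by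
  have hmeas : ∀ Y : Ω → ℝ, Measurable Y → Integrable
      (Set.indicator {ω | ε ω ≤ Y ω} (fun _ => (1 : ℝ))) μ := fun Y hY =>
    (integrable_const _).indicator (measurableSet_le hε hY)
  have hcj : Measurable fun ω => c (j ω) := (measurable_from_top (f := c)).comp (hj.mono hm le_rfl)
  have key : ∀ i : ℤ, ∀ᵐ ω ∂μ, j ω = i →
      (μ[Set.indicator {ω | ε ω ≤ c (j ω)} (fun _ => (1 : ℝ)) | m]) ω = F ω (c i) := by
    intro i
    have hs : MeasurableSet[m] (j ⁻¹' {i}) := hj (measurableSet_singleton i)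
    have h1 := condExp_indicator (hmeas _ hcj) hs
    have h2 := condExp_indicator (hmeas _ (measurable_const (a := c i))) hs
    have h3 : (j ⁻¹' {i}).indicator (Set.indicator {ω | ε ω ≤ c (j ω)} (fun _ => (1 : ℝ))) =
        (j ⁻¹' {i}).indicator (Set.indicator {ω | ε ω ≤ c i} (fun _ => (1 : ℝ))) := by
      ext ω
      by_cases h : j ω = i <;> simp [Set.indicator, h]
    rw [h3] at h1
    filter_upwards [h1, h2, hF (c i)] with ω h1 h2 h4 hω
    rw [h1] at h2
    have hmem : ω ∈ j ⁻¹' {i} := hω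
    rw [Set.indicator_of_mem hmem, Set.indicator_of_mem hmem] at h2
    rw [h2, h4]
  filter_upwards [ae_all_iff.2 key] with ω hω
  exact hω _ rfl

theorem condExp_indicator_le_of_measurable (hm : m ≤ mΩ) (hε : Measurable ε)
    (hFm : ∀ x, Measurable[m] fun ω => F ω x) (hFc : ∀ᵐ ω ∂μ, Continuous (F ω))
    (hF01 : ∀ᵐ ω ∂μ, ∀ x, 0 ≤ F ω x ∧ F ω x ≤ 1)
    (hF : ∀ x, (fun ω => F ω x) =ᵐ[μ] μ[Set.indicator {ω | ε ω ≤ x} (fun _ => (1 : ℝ)) | m])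
    {X : Ω → ℝ} (hX : Measurable[m] X) :
    μ[Set.indicator {ω | ε ω ≤ X ω} (fun _ => (1 : ℝ)) | m] =ᵐ[μ] fun ω => F ω (X ω) := by
  have hFX : ∀ Y : Ω → ℝ, Measurable[m] Y → AEStronglyMeasurable[m] (fun ω => F ω (Y ω)) μ :=
    fun Y hY => aestronglyMeasurable_of_measurable_completed
      (measurable_completed_comp_of_continuous hFm hFc (hY.mono (le_completed m μ) le_rfl))
  have hFi : ∀ Y : Ω → ℝ, Measurable[m] Y → Integrable (fun ω => F ω (Y ω)) μ := fun Y hY =>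
    integrable_of_forall_abs_le ((hFX Y hY).mono hm) (c := 1) (by
      filter_upwards [hF01] with ω hω
      rw [abs_of_nonneg (hω _).1]; exact (hω _).2)
  -- X is approximated by grid points strictly above it: x ↦ 1{ε ≤ x} is right-continuous, so the
  -- indicators converge at every ω.
  set j : ℕ → Ω → ℤ := fun n ω => ⌊X ω * (n + 1)⌋ with hj
  set c : ℕ → ℤ → ℝ := fun n i => ((i : ℝ) + 1) / (n + 1) with hc
  have hjm : ∀ n, Measurable[m] (j n) := fun n => Int.measurable_floor.comp (hX.mul_const _)
  have hcjm : ∀ n, Measurable[m] fun ω => c n (j n ω) := fun n =>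
    (measurable_from_top (f := c n)).comp (hjm n)
  have hgt : ∀ n ω, X ω < c n (j n ω) := by
    intro n ω
    simp only [hc, hj]
    rw [lt_div_iff₀ (by positivity)]
    exact Int.lt_floor_add_one _
  have hle : ∀ n ω, c n (j n ω) ≤ X ω + 1 / ((n : ℝ) + 1) := by
    intro n ω
    simp only [hc, hj]
    rw [add_div]
    gcongr
    rw [div_le_iff₀ (by positivity)]
    exact Int.floor_le _
  have hlim : ∀ ω, Tendsto (fun n => c n (j n ω)) atTop (nhds (X ω)) := by
    intro ω
    have h1 : Tendsto (fun n : ℕ => X ω + 1 / ((n : ℝ) + 1)) atTop (nhds (X ω + 0)) :=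
      tendsto_const_nhds.add tendsto_one_div_add_atTop_nhds_zero_nat
    rw [add_zero] at h1
    exact tendsto_of_tendsto_of_tendsto_of_le_of_le tendsto_const_nhds h1
      (fun n => (hgt n ω).le) (fun n => hle n ω)
  have hexp := tendsto_condExp_unique (m := m) (μ := μ)
    (fun n => Set.indicator {ω | ε ω ≤ c n (j n ω)} (fun _ => (1 : ℝ)))
    (fun n ω => F ω (c n (j n ω)))
    (Set.indicator {ω | ε ω ≤ X ω} (fun _ => (1 : ℝ))) (fun ω => F ω (X ω))
    (fun n => (integrable_const _).indicator (measurableSet_le hε ((hcjm n).mono hm le_rfl)))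
    (fun n => hFi _ (hcjm n))
    (Eventually.of_forall fun ω => by
      by_cases h : ε ω ≤ X ω
      · refine tendsto_const_nhds.congr fun n => ?_
        have : ε ω ≤ c n (j n ω) := h.trans (hgt n ω).le
        simp [Set.indicator, h, this]
      · refine tendsto_const_nhds.congr' ?_
        filter_upwards [(hlim ω).eventually_lt_const (not_le.1 h)] with n hn
        simp [Set.indicator, h, not_le.2 hn])
    (by
      filter_upwards [hFc] with ω hω
      exact (hω.tendsto _).comp (hlim ω))
    (fun _ => 1) (integrable_const _) (fun _ => 1) (integrable_const _)
    (fun n => Eventually.of_forall fun ω => by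
      by_cases h : ε ω ≤ c n (j n ω) <;> simp [Set.indicator, h])
    (fun n => by
      filter_upwards [hF01] with ω hω
      rw [Real.norm_eq_abs, abs_of_nonneg (hω _).1]; exact (hω _).2)
    (fun n => by
      refine (condExp_indicator_le_of_countable_range hm hε hF (hjm n) (c n)).trans ?_
      exact (condExp_of_aestronglyMeasurable' hm (hFX _ (hcjm n)) (hFi _ (hcjm n))).symm)
  exact hexp.trans (condExp_of_aestronglyMeasurable' hm (hFX _ hX) (hFi _ hX))

/-- The conditional probability of `ε ≤ X`, for `X` known, is the conditional distribution
function of `ε` at `X`. -/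
theorem condExp_indicator_le (hm : m ≤ mΩ) (hε : Measurable ε)
    (hFm : ∀ x, Measurable[m] fun ω => F ω x) (hFc : ∀ᵐ ω ∂μ, Continuous (F ω))
    (hF01 : ∀ᵐ ω ∂μ, ∀ x, 0 ≤ F ω x ∧ F ω x ≤ 1)
    (hF : ∀ x, (fun ω => F ω x) =ᵐ[μ] μ[Set.indicator {ω | ε ω ≤ x} (fun _ => (1 : ℝ)) | m])
    {X : Ω → ℝ} (hX : Measurable[completed m μ] X) :
    μ[Set.indicator {ω | ε ω ≤ X ω} (fun _ => (1 : ℝ)) | m] =ᵐ[μ] fun ω => F ω (X ω) := by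
  obtain ⟨Y, hY, hXY⟩ := aestronglyMeasurable_of_measurable_completed hX
  have h1 : Set.indicator {ω | ε ω ≤ X ω} (fun _ => (1 : ℝ)) =ᵐ[μ]
      Set.indicator {ω | ε ω ≤ Y ω} (fun _ => (1 : ℝ)) := by
    filter_upwards [hXY] with ω hω
    simp [Set.indicator, hω]
  refine (condExp_congr_ae h1).trans
    ((condExp_indicator_le_of_measurable hm hε hFm hFc hF01 hF hY.measurable).trans ?_)
  filter_upwards [hXY] with ω hω
  rw [hω]

theorem integrable_indicator_le_of_completed (hm : m ≤ mΩ) (hε : Measurable ε) {X : Ω → ℝ}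
    (hX : Measurable[completed m μ] X) :
    Integrable (Set.indicator {ω | ε ω ≤ X ω} (fun _ => (1 : ℝ))) μ := by
  have hX' := (aestronglyMeasurable_of_measurable_completed hX).mono hm
  exact (integrable_const _).indicator₀ (nullMeasurableSet_le hε.aemeasurable hX'.aemeasurable)

/-- P(ε = X) is at most E[F(X) - F(X - 1/(n+1))], which tends to 0 by dominated convergence. This
excludes ties between the noise and the level where the innovation changes sign. -/
theorem ae_ne_of_measurable_completed (hm : m ≤ mΩ) (hε : Measurable ε)
    (hFm : ∀ x, Measurable[m] fun ω => F ω x) (hFc : ∀ᵐ ω ∂μ, Continuous (F ω))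
    (hF01 : ∀ᵐ ω ∂μ, ∀ x, 0 ≤ F ω x ∧ F ω x ≤ 1)
    (hF : ∀ x, (fun ω => F ω x) =ᵐ[μ] μ[Set.indicator {ω | ε ω ≤ x} (fun _ => (1 : ℝ)) | m])
    {X : Ω → ℝ} (hX : Measurable[completed m μ] X) : ∀ᵐ ω ∂μ, ε ω ≠ X ω := by
  have hXn : ∀ n : ℕ, Measurable[completed m μ] fun ω => X ω - 1 / ((n : ℝ) + 1) := fun n =>
    hX.sub_const _
  have hFX : ∀ Y : Ω → ℝ, Measurable[completed m μ] Y →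
      AEStronglyMeasurable (fun ω => F ω (Y ω)) μ := fun Y hY =>
    (aestronglyMeasurable_of_measurable_completed
      (measurable_completed_comp_of_continuous hFm hFc hY)).mono hm
  have hint : ∀ Y : Ω → ℝ, Measurable[completed m μ] Y →
      ∫ ω, Set.indicator {ω | ε ω ≤ Y ω} (fun _ => (1 : ℝ)) ω ∂μ = ∫ ω, F ω (Y ω) ∂μ := by
    intro Y hY
    rw [← integral_condExp hm]
    exact integral_congr_ae (condExp_indicator_le hm hε hFm hFc hF01 hF hY)
  have hXae := (aestronglyMeasurable_of_measurable_completed hX).mono hm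
  have hnull : NullMeasurableSet {ω | ε ω = X ω} μ :=
    nullMeasurableSet_eq_fun hε.aemeasurable hXae.aemeasurable
  have hb : ∀ n : ℕ, μ.real {ω | ε ω = X ω} ≤
      (∫ ω, F ω (X ω) ∂μ) - ∫ ω, F ω (X ω - 1 / ((n : ℝ) + 1)) ∂μ := by
    intro n
    have hn : (0 : ℝ) < 1 / ((n : ℝ) + 1) := by positivity
    rw [← hint _ hX, ← hint _ (hXn n), ← integral_sub
      (integrable_indicator_le_of_completed hm hε hX)
      (integrable_indicator_le_of_completed hm hε (hXn n))]
    have : μ.real {ω | ε ω = X ω} =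
        ∫ ω, Set.indicator {ω | ε ω = X ω} (fun _ => (1 : ℝ)) ω ∂μ := by
      rw [integral_indicator₀ hnull]; simp
    rw [this]
    refine integral_mono ((integrable_const _).indicator₀ hnull)
      ((integrable_indicator_le_of_completed hm hε hX).sub
      (integrable_indicator_le_of_completed hm hε (hXn n))) fun ω => ?_
    simp only [Set.indicator, Set.mem_ofPred_eq]
    split_ifs <;> linarith
  have hlim : Tendsto (fun n : ℕ => (∫ ω, F ω (X ω) ∂μ) -
      ∫ ω, F ω (X ω - 1 / ((n : ℝ) + 1)) ∂μ) atTop (nhds 0) := by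
    rw [← sub_self (∫ ω, F ω (X ω) ∂μ)]
    refine tendsto_const_nhds.sub (tendsto_integral_of_dominated_convergence (fun _ => 1)
      (fun n => hFX _ (hXn n)) (integrable_const _) (fun n => ?_) ?_)
    · filter_upwards [hF01] with ω hω
      rw [Real.norm_eq_abs, abs_of_nonneg (hω _).1]; exact (hω _).2
    · filter_upwards [hFc] with ω hω
      refine (hω.tendsto _).comp ?_
      have : Tendsto (fun n : ℕ => X ω - 1 / ((n : ℝ) + 1)) atTop (nhds (X ω - 0)) :=
        tendsto_const_nhds.sub tendsto_one_div_add_atTop_nhds_zero_nat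
      rwa [sub_zero] at this
  have h0 : μ.real {ω | ε ω = X ω} ≤ 0 := ge_of_tendsto' hlim hb
  rw [ae_iff]
  simp only [ne_eq, not_not]
  have := le_antisymm h0 measureReal_nonneg
  rwa [measureReal_eq_zero_iff] at this

end ConditionalDistribution

/-! ### Exponential supermartingale bound for martingale transforms -/

section Martingale

/-- By convexity e^{sw} lies below the chord cosh s + w sinh s, and cosh s ≤ e^{s²/2}. The bound is
affine in w, so a centred w gives it conditional mean 1. -/
theorem exp_mul_sub_sq_le (s : ℝ) {w : ℝ} (hw : |w| ≤ 1) :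
    Real.exp (s * w - s ^ 2 / 2) ≤ 1 + w * (Real.sinh s * Real.exp (-(s ^ 2 / 2))) := by
  have hw' := abs_le.1 hw
  have hconv := convexOn_exp.2 (Set.mem_univ s) (Set.mem_univ (-s))
    (show 0 ≤ (1 + w) / 2 by linarith) (show 0 ≤ (1 - w) / 2 by linarith) (by ring)
  simp only [smul_eq_mul] at hconv
  rw [show (1 + w) / 2 * s + (1 - w) / 2 * -s = s * w by ring] at hconv
  have h1 : Real.exp (s * w) ≤ Real.cosh s + w * Real.sinh s := by
    rw [Real.cosh_eq, Real.sinh_eq]; linarith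
  have h2 : Real.cosh s * Real.exp (-(s ^ 2 / 2)) ≤ 1 := by
    rw [Real.exp_neg, mul_inv_le_iff₀ (Real.exp_pos _), one_mul]
    exact Real.cosh_le_exp_half_sq s
  calc Real.exp (s * w - s ^ 2 / 2) = Real.exp (s * w) * Real.exp (-(s ^ 2 / 2)) := by
        rw [← Real.exp_add]; congr 1
    _ ≤ (Real.cosh s + w * Real.sinh s) * Real.exp (-(s ^ 2 / 2)) := by gcongr
    _ ≤ _ := by linarith

theorem abs_sinh_mul_exp_le (s : ℝ) : |Real.sinh s * Real.exp (-(s ^ 2 / 2))| ≤ 1 := by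
  rw [abs_mul, abs_of_pos (Real.exp_pos _), Real.exp_neg, mul_inv_le_iff₀ (Real.exp_pos _), one_mul]
  refine le_trans ?_ (Real.cosh_le_exp_half_sq s)
  rw [abs_le]
  constructor
  · have := Real.sinh_lt_cosh (-s)
    rw [Real.sinh_neg, Real.cosh_neg] at this
    linarith
  · exact (Real.sinh_lt_cosh s).le

/-- Completing the square bounds the exponent independently of s. Thus the exponential process is
bounded at each fixed time, and the coefficients need no integrability. -/
theorem exp_mul_sub_sq_le_exp_half (s : ℝ) {w : ℝ} (hw : |w| ≤ 1) :
    Real.exp (s * w - s ^ 2 / 2) ≤ Real.exp (1 / 2) := by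
  refine Real.exp_le_exp.2 ?_
  have hw2 : w ^ 2 ≤ 1 := by rw [← sq_abs]; exact pow_le_one₀ (abs_nonneg w) hw
  nlinarith [sq_nonneg (s - w)]

variable {Ω : Type*} {mΩ : MeasurableSpace Ω} {μ : Measure Ω} [IsProbabilityMeasure μ]
  {ℱ : Filtration ℕ mΩ} {s w : ℕ → Ω → ℝ}

/-- The exponential process of the transform of `w` by `s`. -/
noncomputable def expTransform (s w : ℕ → Ω → ℝ) (n : ℕ) (ω : Ω) : ℝ :=
  Real.exp (∑ k ∈ Finset.range n, (s k ω * w k ω - s k ω ^ 2 / 2))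

theorem expTransform_pos (s w : ℕ → Ω → ℝ) (n : ℕ) (ω : Ω) : 0 < expTransform s w n ω :=
  Real.exp_pos _

theorem expTransform_succ (s w : ℕ → Ω → ℝ) (n : ℕ) (ω : Ω) :
    expTransform s w (n + 1) ω =
      expTransform s w n ω * Real.exp (s n ω * w n ω - s n ω ^ 2 / 2) := by
  rw [expTransform, Finset.sum_range_succ, Real.exp_add, expTransform]

theorem expTransform_le (hw1 : ∀ k ω, |w k ω| ≤ 1) (n : ℕ) (ω : Ω) :
    expTransform s w n ω ≤ Real.exp (1 / 2) ^ n := by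
  induction n with
  | zero => simp [expTransform]
  | succ n ih =>
    rw [expTransform_succ, pow_succ]
    exact mul_le_mul ih (exp_mul_sub_sq_le_exp_half _ (hw1 n ω)) (Real.exp_pos _).le
      (pow_pos (Real.exp_pos _) n).le

theorem stronglyMeasurable_expTransform (hs : ∀ k, StronglyMeasurable[ℱ k] (s k))
    (hw : ∀ k, StronglyMeasurable[ℱ (k + 1)] (w k)) (n : ℕ) :
    StronglyMeasurable[ℱ n] (expTransform s w n) := by
  unfold expTransform
  refine Real.continuous_exp.comp_stronglyMeasurable
    (Finset.stronglyMeasurable_fun_sum _ fun k hk => ?_)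
  have hk' := Finset.mem_range.1 hk
  have h1 : StronglyMeasurable[ℱ n] (s k) := (hs k).mono (ℱ.mono hk'.le)
  have h2 : StronglyMeasurable[ℱ n] (w k) := (hw k).mono (ℱ.mono hk')
  exact (h1.mul h2).sub ((h1.pow 2).div stronglyMeasurable_const)

theorem integrable_expTransform (hs : ∀ k, StronglyMeasurable[ℱ k] (s k))
    (hw : ∀ k, StronglyMeasurable[ℱ (k + 1)] (w k)) (hw1 : ∀ k ω, |w k ω| ≤ 1) (n : ℕ) :
    Integrable (expTransform s w n) μ :=
  Integrable.of_bound ((stronglyMeasurable_expTransform hs hw n).mono (ℱ.le n)).aestronglyMeasurable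
    (Real.exp (1 / 2) ^ n) (Eventually.of_forall fun ω => by
      rw [Real.norm_eq_abs, abs_of_pos (expTransform_pos s w n ω)]; exact expTransform_le hw1 n ω)

theorem supermartingale_expTransform (hs : ∀ k, StronglyMeasurable[ℱ k] (s k))
    (hw : ∀ k, StronglyMeasurable[ℱ (k + 1)] (w k)) (hw1 : ∀ k ω, |w k ω| ≤ 1)
    (hw0 : ∀ k, μ[w k | ℱ k] =ᵐ[μ] 0) : Supermartingale (expTransform s w) ℱ μ := by
  refine supermartingale_nat (stronglyMeasurable_expTransform hs hw)
    (integrable_expTransform hs hw hw1) fun n => ?_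
  set c : Ω → ℝ := fun ω => Real.sinh (s n ω) * Real.exp (-(s n ω ^ 2 / 2)) with hc
  set Z := expTransform s w n with hZ
  have hZm := stronglyMeasurable_expTransform hs hw n
  have hcm : StronglyMeasurable[ℱ n] c :=
    (by fun_prop : Continuous fun x : ℝ => Real.sinh x * Real.exp (-(x ^ 2 / 2))
      ).comp_stronglyMeasurable (hs n)
  have hwm : AEStronglyMeasurable (w n) μ := ((hw n).mono (ℱ.le _)).aestronglyMeasurable
  have hwi : Integrable (w n) μ := Integrable.of_bound hwm 1 (Eventually.of_forall (hw1 n))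
  have hZci : Integrable (fun ω => (Z ω * c ω) * w n ω) μ := by
    refine Integrable.of_bound ((((hZm.mul hcm).mono (ℱ.le n)).aestronglyMeasurable).mul hwm)
      (Real.exp (1 / 2) ^ n) (Eventually.of_forall fun ω => ?_)
    rw [Real.norm_eq_abs, abs_mul, abs_mul, abs_of_pos (expTransform_pos s w n ω)]
    have h1 : Z ω * |c ω| ≤ Real.exp (1 / 2) ^ n * 1 :=
      mul_le_mul (expTransform_le hw1 n ω) (abs_sinh_mul_exp_le _) (abs_nonneg _) (by positivity)
    calc Z ω * |c ω| * |w n ω| ≤ Real.exp (1 / 2) ^ n * 1 * 1 :=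
          mul_le_mul h1 (hw1 n ω) (abs_nonneg _) (by positivity)
      _ = _ := by ring
  have hZi := integrable_expTransform (μ := μ) hs hw hw1 n
  have h1 : μ[expTransform s w (n + 1) | ℱ n] ≤ᵐ[μ] μ[fun ω => Z ω + (Z ω * c ω) * w n ω | ℱ n] := by
    refine condExp_mono (integrable_expTransform hs hw hw1 _) (hZi.add hZci)
      (Eventually.of_forall fun ω => ?_)
    change expTransform s w (n + 1) ω ≤ Z ω + (Z ω * c ω) * w n ω
    rw [expTransform_succ]
    have := mul_le_mul_of_nonneg_left (exp_mul_sub_sq_le (s n ω) (hw1 n ω))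
      (Real.exp_pos (∑ k ∈ Finset.range n, (s k ω * w k ω - s k ω ^ 2 / 2))).le
    change Z ω * _ ≤ Z ω * (1 + w n ω * c ω) at this
    change Z ω * _ ≤ _
    linarith
  have h2 : μ[fun ω => Z ω + (Z ω * c ω) * w n ω | ℱ n] =ᵐ[μ]
      μ[Z | ℱ n] + μ[fun ω => (Z ω * c ω) * w n ω | ℱ n] := condExp_add hZi hZci _
  have h3 : μ[fun ω => (Z ω * c ω) * w n ω | ℱ n] =ᵐ[μ] (fun ω => Z ω * c ω) * μ[w n | ℱ n] :=
    condExp_mul_of_stronglyMeasurable_left (hZm.mul hcm) hZci hwi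
  have h4 : μ[Z | ℱ n] = Z := condExp_of_stronglyMeasurable (ℱ.le n) hZm hZi
  filter_upwards [h1, h2, h3, hw0 n] with ω h1 h2 h3 h5
  rw [h2, Pi.add_apply, h3, h4, Pi.mul_apply, h5] at h1
  simpa using h1

/-- A positive supermartingale started at 1 is bounded in L¹, hence converges and is bounded along
almost every path. -/
theorem ae_bddAbove_expTransform (hs : ∀ k, StronglyMeasurable[ℱ k] (s k))
    (hw : ∀ k, StronglyMeasurable[ℱ (k + 1)] (w k)) (hw1 : ∀ k ω, |w k ω| ≤ 1)
    (hw0 : ∀ k, μ[w k | ℱ k] =ᵐ[μ] 0) :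
    ∀ᵐ ω ∂μ, BddAbove (Set.range fun n => expTransform s w n ω) := by
  have hsup := supermartingale_expTransform hs hw hw1 hw0
  have hbdd : ∀ n, eLpNorm ((-expTransform s w) n) 1 μ ≤ (1 : NNReal) := by
    intro n
    rw [Pi.neg_apply, eLpNorm_neg, eLpNorm_one_eq_lintegral_enorm,
      ← ofReal_integral_norm_eq_lintegral_enorm (integrable_expTransform hs hw hw1 n)]
    have h1 : ∫ ω, ‖expTransform s w n ω‖ ∂μ = ∫ ω, expTransform s w n ω ∂μ :=
      integral_congr_ae (Eventually.of_forall fun ω => by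
        simp only [Real.norm_eq_abs]; exact abs_of_pos (Real.exp_pos _))
    have h2 := hsup.setIntegral_le (Nat.zero_le n) MeasurableSet.univ
    have h3 : ∫ ω, expTransform s w 0 ω ∂μ = 1 := by simp [expTransform]
    simp only [Measure.restrict_univ] at h2
    rw [h1]
    calc ENNReal.ofReal (∫ ω, expTransform s w n ω ∂μ) ≤ ENNReal.ofReal 1 :=
          ENNReal.ofReal_le_ofReal (by linarith)
      _ = _ := by simp
  filter_upwards [hsup.neg.ae_tendsto_limitProcess hbdd] with ω hω
  have := hω.neg
  simpa using this.bddAbove_range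

/-- A transform of a bounded martingale difference sequence is dominated, up to a constant, by any
positive multiple of the sum of the squares of the coefficients. -/
theorem ae_sum_mul_le_of_stronglyMeasurable (hs : ∀ k, StronglyMeasurable[ℱ k] (s k))
    (hw : ∀ k, StronglyMeasurable[ℱ (k + 1)] (w k)) (hw1 : ∀ k ω, |w k ω| ≤ 1)
    (hw0 : ∀ k, μ[w k | ℱ k] =ᵐ[μ] 0) :
    ∀ᵐ ω ∂μ, ∀ η : ℝ, 0 < η → ∃ K : ℝ, ∀ n, ∑ k ∈ Finset.range n, s k ω * w k ω ≤
      η * ∑ k ∈ Finset.range n, s k ω ^ 2 + K := by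
  -- With coefficients r·s, the logarithm of the bounded process leaves the factor r/2 on the sum of
  -- squares. The values r = 1/(j+1) are countable and arbitrarily small.
  have h : ∀ j : ℕ, ∀ᵐ ω ∂μ, BddAbove (Set.range fun n =>
      expTransform (fun k ω => (1 / ((j : ℝ) + 1)) * s k ω) w n ω) := fun j =>
    ae_bddAbove_expTransform (ℱ := ℱ) (fun k => stronglyMeasurable_const.mul (hs k)) hw hw1 hw0
  filter_upwards [ae_all_iff.2 h] with ω hω η hη
  obtain ⟨j, hj⟩ := exists_nat_one_div_lt hη
  set r : ℝ := 1 / ((j : ℝ) + 1) with hr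
  have hr0 : 0 < r := by positivity
  obtain ⟨B, hB⟩ := hω j
  refine ⟨Real.log B / r, fun n => ?_⟩
  have h1 : expTransform (fun k ω => r * s k ω) w n ω ≤ B := hB ⟨n, rfl⟩
  have h2 := Real.log_le_log (Real.exp_pos _) h1
  simp only [Real.log_exp] at h2
  have h3 : ∑ k ∈ Finset.range n, (r * s k ω * w k ω - (r * s k ω) ^ 2 / 2) =
      r * (∑ k ∈ Finset.range n, s k ω * w k ω - r / 2 * ∑ k ∈ Finset.range n, s k ω ^ 2) := by
    rw [Finset.mul_sum, ← Finset.sum_sub_distrib, Finset.mul_sum]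
    exact Finset.sum_congr rfl fun k _ => by ring
  rw [h3, mul_comm, ← le_div_iff₀ hr0] at h2
  have h4 : r / 2 * ∑ k ∈ Finset.range n, s k ω ^ 2 ≤ η * ∑ k ∈ Finset.range n, s k ω ^ 2 :=
    mul_le_mul_of_nonneg_right (by linarith) (Finset.sum_nonneg fun k _ => sq_nonneg _)
  linarith

theorem ae_sum_mul_le (hs : ∀ k, AEStronglyMeasurable[ℱ k] (s k) μ)
    (hw : ∀ k, AEStronglyMeasurable[ℱ (k + 1)] (w k) μ) (hw1 : ∀ k, ∀ᵐ ω ∂μ, |w k ω| ≤ 1)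
    (hw0 : ∀ k, μ[w k | ℱ k] =ᵐ[μ] 0) :
    ∀ᵐ ω ∂μ, ∀ η : ℝ, 0 < η → ∃ K : ℝ, ∀ n, ∑ k ∈ Finset.range n, s k ω * w k ω ≤
      η * ∑ k ∈ Finset.range n, s k ω ^ 2 + K := by
  choose s' hs' hss using hs
  choose w' hw' hww using hw
  -- Clipping the adapted versions of w to [-1, 1] makes the bound hold at every ω and changes them
  -- only on null sets.
  have hclip : Continuous fun x : ℝ => max (-1) (min 1 x) := by fun_prop
  have hww' : ∀ k, w k =ᵐ[μ] fun ω => max (-1) (min 1 (w' k ω)) := by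
    intro k
    filter_upwards [hww k, hw1 k] with ω h1 h2
    rw [← h1, min_eq_right (abs_le.1 h2).2, max_eq_right (abs_le.1 h2).1]
  have h := ae_sum_mul_le_of_stronglyMeasurable (μ := μ) (ℱ := ℱ) hs'
    (fun k => hclip.comp_stronglyMeasurable (hw' k))
    (fun k ω => abs_le.2 ⟨le_max_left _ _, max_le (by norm_num) (min_le_left _ _)⟩)
    (fun k => (condExp_congr_ae (hww' k)).symm.trans (hw0 k))
  filter_upwards [h, ae_all_iff.2 hss, ae_all_iff.2 hww'] with ω h h1 h2
  simpa only [h1, h2] using h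

end Martingale

end TSWLAD

namespace TSWLAD

/-! ### Deterministic summation and drift inequalities -/

section Scalar

/-- The drift contributes -κ' ∑ δ². The noise coefficients are O(|δ|), so the transform consumes
only half of it; the other half is bounded by the initial energy, the growth of Λ and ∑ q². -/
theorem sum_sq_le_of_energy {V Λ δ β b μ v w ψ γ q : ℕ → ℝ} {β₁ μ₁ μ₂ c κ K : ℝ}
    (hV : ∀ k, 0 ≤ V k) (hΛ : Monotone Λ)
    (hstep : ∀ k, V (k + 1) ≤ V k + β k * b k ^ 2 / μ k * δ k ^ 2 - 2 * (b k / μ k) * v k * δ k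
      + v k ^ 2 / (β k * μ k) * (Λ (k + 1) - Λ k))
    (hβ₁ : 0 < β₁) (hβ : ∀ k, β₁ ≤ β k) (hμ₁ : 0 < μ₁) (hμ : ∀ k, μ₁ ≤ μ k ∧ μ k ≤ μ₂)
    (hc : 0 < c) (hb : ∀ k, c ≤ b k ∧ b k ≤ 1) (hv : ∀ k, v k = ψ k + γ k * w k)
    (hv2 : ∀ k, |v k| ≤ 2) (hγ : ∀ k, 0 ≤ γ k ∧ γ k ≤ 2) (hκ : 0 < κ) (hK : 0 ≤ K)
    (hdrift : ∀ k, κ * δ k ^ 2 - K * q k ^ 2 ≤ 2 * ψ k * δ k - b k * β k * δ k ^ 2)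
    (hmart : ∀ η : ℝ, 0 < η → ∃ K' : ℝ, ∀ n,
      ∑ k ∈ Finset.range n, (-2 * (b k / μ k) * γ k * δ k) * w k ≤
        η * ∑ k ∈ Finset.range n, (-2 * (b k / μ k) * γ k * δ k) ^ 2 + K') :
    ∃ A B : ℝ, 0 ≤ A ∧ 0 ≤ B ∧ ∀ n, ∑ k ∈ Finset.range n, δ k ^ 2 ≤
      A + B * (Λ n - Λ 0) + B * ∑ k ∈ Finset.range n, q k ^ 2 := by
  have hμ₂ : 0 < μ₂ := hμ₁.trans_le ((hμ 0).1.trans (hμ 0).2)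
  set κ' := κ * (c / μ₂) with hκ'
  have hκ'0 : 0 < κ' := by positivity
  -- The 4 is the bound of v².
  set D := 4 / (β₁ * μ₁) with hD
  have hD0 : 0 < D := by positivity
  -- The squared noise coefficients are at most 16 δ²/μ₁², so this η costs exactly (κ'/2) ∑ δ².
  obtain ⟨K', hK'⟩ := hmart (κ' * μ₁ ^ 2 / 32) (by positivity)
  have hsq : ∀ k, (-2 * (b k / μ k) * γ k * δ k) ^ 2 ≤ 16 / μ₁ ^ 2 * δ k ^ 2 := by
    intro k
    have hμk : 0 < μ k := hμ₁.trans_le (hμ k).1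
    have hbk : 0 < b k := hc.trans_le (hb k).1
    have h1 : (b k / μ k) ≤ 1 / μ₁ := div_le_div₀ zero_le_one (hb k).2 hμ₁ (hμ k).1
    have h2 : (b k / μ k) ^ 2 ≤ (1 / μ₁) ^ 2 := pow_le_pow_left₀ (by positivity) h1 2
    have h3 : γ k ^ 2 ≤ 2 ^ 2 := pow_le_pow_left₀ (hγ k).1 (hγ k).2 2
    calc (-2 * (b k / μ k) * γ k * δ k) ^ 2
        = 4 * ((b k / μ k) ^ 2 * γ k ^ 2) * δ k ^ 2 := by ring
      _ ≤ 4 * ((1 / μ₁) ^ 2 * 2 ^ 2) * δ k ^ 2 := by gcongr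
      _ = _ := by ring
  have hone : ∀ k, V (k + 1) ≤ V k - κ' * δ k ^ 2 + K / μ₁ * q k ^ 2
      + (-2 * (b k / μ k) * γ k * δ k) * w k + D * (Λ (k + 1) - Λ k) := by
    intro k
    have hμk : 0 < μ k := hμ₁.trans_le (hμ k).1
    have hβk : 0 < β k := hβ₁.trans_le (hβ k)
    have hbk : 0 < b k := hc.trans_le (hb k).1
    have h1 : v k ^ 2 / (β k * μ k) ≤ D := by
      refine div_le_div₀ (by norm_num) ?_ (by positivity)
        (mul_le_mul (hβ k) (hμ k).1 hμ₁.le hβk.le)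
      have := sq_le_sq' (abs_le.1 (hv2 k)).1 (abs_le.1 (hv2 k)).2
      linarith
    have h2 : v k ^ 2 / (β k * μ k) * (Λ (k + 1) - Λ k) ≤ D * (Λ (k + 1) - Λ k) :=
      mul_le_mul_of_nonneg_right h1 (sub_nonneg.2 (hΛ k.le_succ))
    have h3 : β k * b k ^ 2 / μ k * δ k ^ 2 - 2 * (b k / μ k) * v k * δ k =
        -((b k / μ k) * (2 * ψ k * δ k - b k * β k * δ k ^ 2))
          + (-2 * (b k / μ k) * γ k * δ k) * w k := by
      rw [hv k]; ring
    have h4 := mul_le_mul_of_nonneg_left (hdrift k) (by positivity : 0 ≤ b k / μ k)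
    have h5 : κ' * δ k ^ 2 ≤ (b k / μ k) * (κ * δ k ^ 2) := by
      have : c / μ₂ ≤ b k / μ k := div_le_div₀ hbk.le (hb k).1 hμk (hμ k).2
      calc κ' * δ k ^ 2 = (c / μ₂) * (κ * δ k ^ 2) := by rw [hκ']; ring
        _ ≤ _ := by gcongr
    have h6 : (b k / μ k) * (K * q k ^ 2) ≤ K / μ₁ * q k ^ 2 := by
      have : b k / μ k ≤ 1 / μ₁ := div_le_div₀ zero_le_one (hb k).2 hμ₁ (hμ k).1
      calc (b k / μ k) * (K * q k ^ 2) ≤ (1 / μ₁) * (K * q k ^ 2) := by gcongr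
        _ = _ := by ring
    have := hstep k
    rw [mul_sub] at h4
    linarith
  have hsum : ∀ n, V n ≤ V 0 - κ' * ∑ k ∈ Finset.range n, δ k ^ 2
      + K / μ₁ * ∑ k ∈ Finset.range n, q k ^ 2
      + ∑ k ∈ Finset.range n, (-2 * (b k / μ k) * γ k * δ k) * w k + D * (Λ n - Λ 0) := by
    intro n
    induction n with
    | zero => simp
    | succ n ih =>
      rw [Finset.sum_range_succ, Finset.sum_range_succ, Finset.sum_range_succ]
      have := hone n
      linarith
  set B := 2 / κ' * (K / μ₁ + D) with hB
  have hB0 : 0 ≤ B := by positivity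
  refine ⟨2 / κ' * (V 0 + |K'|), B, mul_nonneg (by positivity) (add_nonneg (hV 0) (abs_nonneg _)),
    hB0, fun n => ?_⟩
  set Sδ := ∑ k ∈ Finset.range n, δ k ^ 2
  set Sq := ∑ k ∈ Finset.range n, q k ^ 2
  have hSq : 0 ≤ Sq := Finset.sum_nonneg fun k _ => sq_nonneg _
  have hΛn : 0 ≤ Λ n - Λ 0 := sub_nonneg.2 (hΛ n.zero_le)
  have h1 : ∑ k ∈ Finset.range n, (-2 * (b k / μ k) * γ k * δ k) ^ 2 ≤ 16 / μ₁ ^ 2 * Sδ := by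
    rw [Finset.mul_sum]
    exact Finset.sum_le_sum fun k _ => hsq k
  have h2 := mul_le_mul_of_nonneg_left h1 (by positivity : 0 ≤ κ' * μ₁ ^ 2 / 32)
  have h3 : κ' * μ₁ ^ 2 / 32 * (16 / μ₁ ^ 2 * Sδ) = κ' / 2 * Sδ := by
    field_simp
    ring
  have h4 := hK' n
  have h5 := hsum n
  have h6 := hV n
  have h7 : κ' / 2 * Sδ ≤ V 0 + |K'| + (K / μ₁ + D) * (Λ n - Λ 0) + (K / μ₁ + D) * Sq := by
    have h8 : 0 ≤ K / μ₁ * (Λ n - Λ 0) := by positivity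
    have h9 : 0 ≤ D * Sq := by positivity
    have := le_abs_self K'
    linarith
  have h8 := mul_le_mul_of_nonneg_left h7 (by positivity : 0 ≤ 2 / κ')
  have h9 : 2 / κ' * (κ' / 2 * Sδ) = Sδ := by field_simp
  rw [h9] at h8
  rw [hB]
  linarith

/-- Drift of the accelerated recursion: `H` is the increment of the conditional mean of the
innovation, `β` its slope between `p` and `q`. -/
theorem drift_of_slope {c₁ c₂ b β γ p q z Hq Hz : ℝ} (hc₁ : 0 < c₁) (hb : b ≤ 1)
    (hβ0 : 0 ≤ β) (hβ : β ≤ 2 * c₂) (hγ : 1 ≤ γ ∧ γ ≤ 2) (hslope : β * (q - p) = γ * Hq)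
    (hHz : c₁ * (z - p) ^ 2 ≤ Hz * (z - p)) (hHqz : |Hq - Hz| ≤ c₂ * |q - z|) :
    c₁ / 2 * (z - p) ^ 2 - 8 * c₂ ^ 2 / c₁ * (q - z) ^ 2 ≤
      2 * (γ * Hz) * (z - p) - b * β * (z - p) ^ 2 := by
  set δ := z - p
  -- Split δ = (q - p) + (z - q) and use the slope identity on the first part. Of the two copies of
  -- γ Hz δ in the goal, one pays for βδ² up to errors in q - z and the other yields c₁δ².
  have h1 : β * δ ^ 2 = γ * Hz * δ + γ * (Hq - Hz) * δ + β * (z - q) * δ := by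
    have : δ = (q - p) + (z - q) := by ring
    calc β * δ ^ 2 = β * ((q - p) + (z - q)) * δ := by rw [← this]; ring
      _ = (β * (q - p)) * δ + β * (z - q) * δ := by ring
      _ = _ := by rw [hslope]; ring
  have h2 : γ * (Hq - Hz) * δ ≤ 2 * (c₂ * |q - z|) * |δ| := by
    calc γ * (Hq - Hz) * δ ≤ |γ * (Hq - Hz) * δ| := le_abs_self _
      _ = γ * |Hq - Hz| * |δ| := by rw [abs_mul, abs_mul, abs_of_pos (by linarith [hγ.1])]
      _ ≤ _ := by gcongr; exact hγ.2
  have h3 : β * (z - q) * δ ≤ 2 * c₂ * |q - z| * |δ| := by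
    calc β * (z - q) * δ ≤ |β * (z - q) * δ| := le_abs_self _
      _ = β * |q - z| * |δ| := by rw [abs_mul, abs_mul, abs_of_nonneg hβ0, abs_sub_comm]
      _ ≤ _ := by gcongr
  have h4 : b * β * δ ^ 2 ≤ β * δ ^ 2 := by
    have : 0 ≤ β * δ ^ 2 := by positivity
    nlinarith
  have h5 : c₁ * δ ^ 2 ≤ γ * Hz * δ := by
    have h0 : 0 ≤ Hz * δ := le_trans (by positivity) hHz
    nlinarith [hγ.1]
  -- Young's inequality, weighted to spend half of c₁δ².
  have h6 : 4 * c₂ * |q - z| * |δ| ≤ c₁ / 2 * δ ^ 2 + 8 * c₂ ^ 2 / c₁ * (q - z) ^ 2 := by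
    have h := sq_nonneg (c₁ * |δ| - 4 * c₂ * |q - z|)
    have h' : 0 ≤ (c₁ * |δ| - 4 * c₂ * |q - z|) ^ 2 / (2 * c₁) := by positivity
    have e : (c₁ * |δ| - 4 * c₂ * |q - z|) ^ 2 / (2 * c₁) =
        c₁ / 2 * |δ| ^ 2 + 8 * c₂ ^ 2 / c₁ * |q - z| ^ 2 - 4 * c₂ * |q - z| * |δ| := by
      field_simp
      ring
    rw [e, sq_abs, sq_abs] at h'
    linarith
  nlinarith

end Scalar

/-! ### Continuous saturation -/

section Saturation

variable {l u p x : ℝ}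

theorem sat_of_le (hlu : l < u) (h : p ≤ l) : sat l u l u p = l := by
  unfold sat
  rcases h.lt_or_eq with h | h
  · rw [if_pos h]
  · rw [if_neg (by linarith), if_pos (by linarith), h]

theorem sat_of_ge (hlu : l < u) (h : u ≤ p) : sat l u l u p = u := by
  unfold sat
  rw [if_neg (by linarith)]
  split_ifs <;> linarith

theorem sat_of_mem (h₁ : l ≤ p) (h₂ : p ≤ u) : sat l u l u p = p := by
  unfold sat
  rw [if_neg (by linarith), if_pos h₂]

theorem abs_sat_sub_sat_le (hlu : l ≤ u) : |sat l u l u x - sat l u l u p| ≤ |x - p| := by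
  unfold sat
  split_ifs <;> rw [abs_le] <;> constructor <;> cases abs_cases (x - p) <;> linarith

/-- This explains the interval in the definition of β̄. If p is cut off at l, then l - x ≤ C + l and
x - l ≤ x - p ≤ 2C; the upper threshold is symmetric. -/
theorem abs_sat_sub_le {C : ℝ} (hp : |p| ≤ C) (hx : |x| ≤ C) :
    |sat l u l u p - x| ≤ max (2 * C) (max (C + l) (C - u)) := by
  have h1 := le_max_left (2 * C) (max (C + l) (C - u))
  have h2 := (le_max_left (C + l) (C - u)).trans (le_max_right (2 * C) (max (C + l) (C - u)))
  have h3 := (le_max_right (C + l) (C - u)).trans (le_max_right (2 * C) (max (C + l) (C - u)))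
  have hp' := abs_le.1 hp
  have hx' := abs_le.1 hx
  unfold sat
  split_ifs <;> rw [abs_le] <;> constructor <;> linarith

end Saturation

/-! ### Analysis along a fixed path -/

namespace Model

variable {Ω : Type*} {d : ℕ} (m : Model Ω d)

/-- The sensitivity of the innovation: `1` in the saturated regions, `2` in between. -/
noncomputable def sens (k : ℕ) (ω : Ω) (t : Fin d → ℝ) : ℝ :=
  open Classical in
  if m.S k ω (m.φ k ω ⬝ᵥ t) = m.L k ω ∨ m.S k ω (m.φ k ω ⬝ᵥ t) = m.U k ω then 1 else 2

/-- The noise level at which the innovation changes its sign. -/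
noncomputable def level (k : ℕ) (ω : Ω) (t : Fin d → ℝ) : ℝ :=
  m.S k ω (m.φ k ω ⬝ᵥ t) - m.φ k ω ⬝ᵥ m.θ

/-- The centred indicator of the noise being below the level. -/
noncomputable def noiseDev (k : ℕ) (ω : Ω) (t : Fin d → ℝ) : ℝ :=
  m.F (k + 1) ω (m.level k ω t) -
    Set.indicator {ω | m.ε (k + 1) ω ≤ m.level k ω t} (fun _ => (1 : ℝ)) ω

/-- The conditional mean of the innovation. -/
noncomputable def meanInnov (k : ℕ) (ω : Ω) (t : Fin d → ℝ) : ℝ :=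
  m.sens k ω t * (m.F (k + 1) ω (m.S k ω (m.φ k ω ⬝ᵥ t) - m.φ k ω ⬝ᵥ t) -
    m.F (k + 1) ω (m.level k ω t))

/-- The radius of the interval on which the density of the noise matters at time `k`. -/
noncomputable def radius (k : ℕ) (ω : Ω) : ℝ :=
  max (2 * m.C k ω) (max (m.C k ω + m.l k ω) (m.C k ω - m.u k ω))

/-- The properties of the model that hold on almost every path. -/
structure GoodPath (ω : Ω) : Prop where
  compact_D : IsCompact m.D
  convex_D : Convex ℝ m.D
  θ_mem : m.θ ∈ m.D
  lower_eq : ∀ k, m.l k ω = m.L k ω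
  upper_eq : ∀ k, m.u k ω = m.U k ω
  lower_lt_upper : ∀ k, m.l k ω < m.u k ω
  le_C : ∀ k, ∀ x ∈ m.D, |m.φ k ω ⬝ᵥ x| ≤ m.C k ω
  b_lower : ∃ c : ℝ, 0 < c ∧ ∀ k, c ≤ m.b k ω
  b_le : ∀ k, m.b k ω ≤ 1
  f_cont : ∀ k, Continuous (m.f (k + 1) ω)
  F_sub : ∀ k x y, m.F (k + 1) ω y - m.F (k + 1) ω x = ∫ t in x..y, m.f (k + 1) ω t
  F_mem : ∀ k x, 0 ≤ m.F (k + 1) ω x ∧ m.F (k + 1) ω x ≤ 1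
  F_zero : ∀ k, m.F (k + 1) ω 0 = 1 / 2
  f_bounds : ∃ c₁ c₂ : ℝ, 0 < c₁ ∧ ∀ k x, |x| ≤ m.radius k ω →
    c₁ ≤ m.f (k + 1) ω x ∧ m.f (k + 1) ω x ≤ c₂

variable {m} {ω : Ω}

theorem sens_mem (k : ℕ) (ω : Ω) (t : Fin d → ℝ) : 1 ≤ m.sens k ω t ∧ m.sens k ω t ≤ 2 := by
  unfold sens
  split_ifs <;> norm_num

namespace GoodPath

variable (g : m.GoodPath ω)
include g

theorem S_eq (k : ℕ) (x : ℝ) : m.S k ω x = sat (m.l k ω) (m.u k ω) (m.l k ω) (m.u k ω) x := by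
  rw [S, ← g.lower_eq, ← g.upper_eq]

theorem abs_S_sub_le_radius (k : ℕ) {t s : Fin d → ℝ} (ht : t ∈ m.D) (hs : s ∈ m.D) :
    |m.S k ω (m.φ k ω ⬝ᵥ t) - m.φ k ω ⬝ᵥ s| ≤ m.radius k ω := by
  rw [g.S_eq]
  exact abs_sat_sub_le (g.le_C k t ht) (g.le_C k s hs)

theorem continuous_F (k : ℕ) : Continuous (m.F (k + 1) ω) := by
  have h : m.F (k + 1) ω = fun y => m.F (k + 1) ω 0 + ∫ t in (0 : ℝ)..y, m.f (k + 1) ω t := by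
    ext y
    rw [← g.F_sub]
    ring
  rw [h]
  exact continuous_const.add (intervalIntegral.continuous_primitive
    (fun a b => (g.f_cont k).intervalIntegrable a b) 0)

theorem mul_sub_le_F_sub (k : ℕ) {c x y : ℝ} (hx : |x| ≤ m.radius k ω) (hy : |y| ≤ m.radius k ω)
    (hxy : x ≤ y) (hc : ∀ t, |t| ≤ m.radius k ω → c ≤ m.f (k + 1) ω t) :
    c * (y - x) ≤ m.F (k + 1) ω y - m.F (k + 1) ω x := by
  rw [g.F_sub]
  have h := intervalIntegral.integral_mono_on (μ := volume) (a := x) (b := y) (f := fun _ => c)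
    (g := m.f (k + 1) ω) hxy intervalIntegrable_const ((g.f_cont k).intervalIntegrable _ _) fun t ht =>
      hc t (abs_le.2 ⟨by linarith [(abs_le.1 hx).1, ht.1], by linarith [(abs_le.1 hy).2, ht.2]⟩)
  rw [intervalIntegral.integral_const, smul_eq_mul] at h
  linarith

theorem F_sub_le_mul_sub (k : ℕ) {c x y : ℝ} (hx : |x| ≤ m.radius k ω) (hy : |y| ≤ m.radius k ω)
    (hxy : x ≤ y) (hc : ∀ t, |t| ≤ m.radius k ω → m.f (k + 1) ω t ≤ c) :
    m.F (k + 1) ω y - m.F (k + 1) ω x ≤ c * (y - x) := by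
  rw [g.F_sub]
  have h := intervalIntegral.integral_mono_on (μ := volume) (a := x) (b := y) (g := fun _ => c)
    (f := m.f (k + 1) ω) hxy ((g.f_cont k).intervalIntegrable _ _) intervalIntegrable_const fun t ht =>
      hc t (abs_le.2 ⟨by linarith [(abs_le.1 hx).1, ht.1], by linarith [(abs_le.1 hy).2, ht.2]⟩)
  rw [intervalIntegral.integral_const, smul_eq_mul] at h
  linarith

theorem mul_sq_le_F_sub_mul (k : ℕ) {c x y : ℝ} (hx : |x| ≤ m.radius k ω)
    (hy : |y| ≤ m.radius k ω) (hc : ∀ t, |t| ≤ m.radius k ω → c ≤ m.f (k + 1) ω t) :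
    c * (y - x) ^ 2 ≤ (m.F (k + 1) ω y - m.F (k + 1) ω x) * (y - x) := by
  rcases le_total x y with h | h
  · have := mul_le_mul_of_nonneg_right (g.mul_sub_le_F_sub k hx hy h hc) (sub_nonneg.2 h)
    linarith
  · have := mul_le_mul_of_nonneg_right (g.mul_sub_le_F_sub k hy hx h hc) (sub_nonneg.2 h)
    linarith

theorem F_sub_mul_le_mul_sq (k : ℕ) {c x y : ℝ} (hx : |x| ≤ m.radius k ω)
    (hy : |y| ≤ m.radius k ω) (hc : ∀ t, |t| ≤ m.radius k ω → m.f (k + 1) ω t ≤ c) :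
    (m.F (k + 1) ω y - m.F (k + 1) ω x) * (y - x) ≤ c * (y - x) ^ 2 := by
  rcases le_total x y with h | h
  · have := mul_le_mul_of_nonneg_right (g.F_sub_le_mul_sub k hx hy h hc) (sub_nonneg.2 h)
    linarith
  · have := mul_le_mul_of_nonneg_right (g.F_sub_le_mul_sub k hy hx h hc) (sub_nonneg.2 h)
    linarith

theorem abs_F_sub_le (k : ℕ) {c x y : ℝ} (hx : |x| ≤ m.radius k ω)
    (hy : |y| ≤ m.radius k ω)
    (hc : ∀ t, |t| ≤ m.radius k ω → 0 ≤ m.f (k + 1) ω t ∧ m.f (k + 1) ω t ≤ c) :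
    |m.F (k + 1) ω y - m.F (k + 1) ω x| ≤ c * |y - x| := by
  rcases le_total x y with h | h
  · have h1 := g.F_sub_le_mul_sub k hx hy h fun t ht => (hc t ht).2
    have h2 := g.mul_sub_le_F_sub k hx hy h fun t ht => (hc t ht).1
    rw [abs_of_nonneg (by linarith), abs_of_nonneg (by linarith)]
    exact h1
  · have h1 := g.F_sub_le_mul_sub k hy hx h fun t ht => (hc t ht).2
    have h2 := g.mul_sub_le_F_sub k hy hx h fun t ht => (hc t ht).1
    rw [abs_of_nonpos (by linarith), abs_of_nonpos (by linarith)]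
    linarith

/-- The corrections merge the three regions: the sign jumps by 1 when saturated and by 2 in between,
where F(0) = 1/2 does the centring. A tie would break the formula in the middle, where the sign is
0, and in the upper region. -/
theorem innov_eq_sens_mul (k : ℕ) (t : Fin d → ℝ) (hne : m.ε (k + 1) ω ≠ m.level k ω t) :
    m.innov k ω t = m.sens k ω t *
      (m.F (k + 1) ω (m.S k ω (m.φ k ω ⬝ᵥ t) - m.φ k ω ⬝ᵥ t) -
        Set.indicator {ω | m.ε (k + 1) ω ≤ m.level k ω t} (fun _ => (1 : ℝ)) ω) := by
  have hlu := g.lower_lt_upper k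
  unfold level at hne ⊢
  unfold innov sens obs
  simp only [Set.indicator, Set.mem_ofPred_eq]
  rw [← g.lower_eq, ← g.upper_eq]
  simp only [g.S_eq] at hne ⊢
  set p := m.φ k ω ⬝ᵥ t
  set z := m.φ k ω ⬝ᵥ m.θ
  set e := m.ε (k + 1) ω
  set l := m.l k ω
  set u := m.u k ω
  rcases le_or_gt p l with hp | hp
  · rw [sat_of_le hlu hp, if_neg hlu.ne, if_pos rfl, if_pos (Or.inl rfl)]
    rcases le_or_gt (z + e) l with h | h
    · rw [sat_of_le hlu h, sub_self, Real.sign_zero, if_pos (by linarith)]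
      ring
    · have h2 : l < sat l u l u (z + e) := by unfold sat; split_ifs <;> linarith
      rw [Real.sign_of_pos (sub_pos.2 h2), if_neg (by linarith)]
      ring
  · rcases le_or_gt u p with hp' | hp'
    · rw [sat_of_ge hlu hp'] at hne ⊢
      rw [if_pos rfl, if_neg hlu.ne', if_pos (Or.inr rfl)]
      rcases le_or_gt u (z + e) with h | h
      · have h2 : ¬ e ≤ u - z := fun h' => hne (le_antisymm h' (by linarith))
        rw [sat_of_ge hlu h, sub_self, Real.sign_zero, if_neg h2]
        ring
      · have h2 : sat l u l u (z + e) < u := by unfold sat; split_ifs <;> linarith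
        rw [Real.sign_of_neg (sub_neg.2 h2), if_pos (by linarith)]
        ring
    · rw [sat_of_mem hp.le hp'.le] at hne ⊢
      rw [if_neg hp'.ne, if_neg hp.ne', if_neg (by rintro (h | h) <;> linarith), sub_self, g.F_zero]
      rcases lt_or_gt_of_ne hne with h | h
      · have h2 : sat l u l u (z + e) < p := by unfold sat; split_ifs <;> linarith
        rw [Real.sign_of_neg (sub_neg.2 h2), if_pos h.le]
        norm_num
      · have h2 : p < sat l u l u (z + e) := by unfold sat; split_ifs <;> linarith
        rw [Real.sign_of_pos (sub_pos.2 h2), if_neg (by linarith)]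
        norm_num

theorem innov_eq (k : ℕ) (t : Fin d → ℝ) (hne : m.ε (k + 1) ω ≠ m.level k ω t) :
    m.innov k ω t = m.meanInnov k ω t + m.sens k ω t * m.noiseDev k ω t := by
  rw [g.innov_eq_sens_mul k t hne, meanInnov, noiseDev]
  ring

theorem abs_innov_le (k : ℕ) (t : Fin d → ℝ) (hne : m.ε (k + 1) ω ≠ m.level k ω t) :
    |m.innov k ω t| ≤ 2 := by
  rw [g.innov_eq_sens_mul k t hne, abs_mul]
  have h1 := sens_mem (m := m) k ω t
  have h2 := g.F_mem k (m.S k ω (m.φ k ω ⬝ᵥ t) - m.φ k ω ⬝ᵥ t)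
  have h3 : |m.F (k + 1) ω (m.S k ω (m.φ k ω ⬝ᵥ t) - m.φ k ω ⬝ᵥ t) -
      Set.indicator {ω | m.ε (k + 1) ω ≤ m.level k ω t} (fun _ => (1 : ℝ)) ω| ≤ 1 := by
    simp only [Set.indicator]
    split_ifs <;> rw [abs_le] <;> constructor <;> linarith
  rw [abs_of_pos (by linarith)]
  nlinarith [abs_nonneg (m.F (k + 1) ω (m.S k ω (m.φ k ω ⬝ᵥ t) - m.φ k ω ⬝ᵥ t) -
      Set.indicator {ω | m.ε (k + 1) ω ≤ m.level k ω t} (fun _ => (1 : ℝ)) ω)]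

/-- In the middle region S(p) = p and F(0) = 1/2, so 1 - 2F(p - q) = 2(F(0) - F(p - q)): all
branches are one difference quotient. It is the slope of the conditional mean innovation for θ̄_k in
the role of θ. -/
theorem beta_eq (k : ℕ) (t : Fin d → ℝ) :
    m.beta k ω t = if m.φ k ω ⬝ᵥ (m.thetaBar k ω - t) ≠ 0 then
      m.sens k ω t * (m.F (k + 1) ω (m.S k ω (m.φ k ω ⬝ᵥ t) - m.φ k ω ⬝ᵥ t) -
        m.F (k + 1) ω (m.S k ω (m.φ k ω ⬝ᵥ t) - m.φ k ω ⬝ᵥ m.thetaBar k ω)) /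
        (m.φ k ω ⬝ᵥ (m.thetaBar k ω - t))
      else m.sens k ω t * m.f (k + 1) ω (m.S k ω (m.φ k ω ⬝ᵥ t) - m.φ k ω ⬝ᵥ t) := by
  have hlu := g.lower_lt_upper k
  unfold beta sens
  rw [← g.lower_eq, ← g.upper_eq]
  simp only [g.S_eq]
  by_cases h1 : sat (m.l k ω) (m.u k ω) (m.l k ω) (m.u k ω) (m.φ k ω ⬝ᵥ t) = m.l k ω
  · simp [h1]
  by_cases h2 : sat (m.l k ω) (m.u k ω) (m.l k ω) (m.u k ω) (m.φ k ω ⬝ᵥ t) = m.u k ω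
  · simp [h2, hlu.ne']
  have h3 : sat (m.l k ω) (m.u k ω) (m.l k ω) (m.u k ω) (m.φ k ω ⬝ᵥ t) = m.φ k ω ⬝ᵥ t := by
    refine sat_of_mem ?_ ?_
    · by_contra! h; exact h1 (sat_of_le hlu h.le)
    · by_contra! h; exact h2 (sat_of_ge hlu h.le)
  rw [h3] at h1 h2 ⊢
  simp only [h1, h2, if_false, sub_self, g.F_zero, or_self]
  congr 2
  ring

theorem beta_mul_eq (k : ℕ) (t : Fin d → ℝ) :
    m.beta k ω t * (m.φ k ω ⬝ᵥ m.thetaBar k ω - m.φ k ω ⬝ᵥ t) = m.sens k ω t *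
      (m.F (k + 1) ω (m.S k ω (m.φ k ω ⬝ᵥ t) - m.φ k ω ⬝ᵥ t) -
        m.F (k + 1) ω (m.S k ω (m.φ k ω ⬝ᵥ t) - m.φ k ω ⬝ᵥ m.thetaBar k ω)) := by
  rw [g.beta_eq, ← dotProduct_sub]
  split_ifs with h
  · rw [div_mul_cancel₀ _ h]
  · rw [not_not] at h
    rw [h]
    rw [dotProduct_sub, sub_eq_zero] at h
    rw [h]
    ring

theorem beta_bounds (k : ℕ) {t : Fin d → ℝ} (ht : t ∈ m.D) (hbar : m.thetaBar k ω ∈ m.D)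
    {c₁ c₂ : ℝ} (hc₁ : 0 < c₁) (hc : ∀ x, |x| ≤ m.radius k ω →
      c₁ ≤ m.f (k + 1) ω x ∧ m.f (k + 1) ω x ≤ c₂) :
    c₁ ≤ m.beta k ω t ∧ m.beta k ω t ≤ 2 * c₂ := by
  have hγ := sens_mem (m := m) k ω t
  have hx := g.abs_S_sub_le_radius k ht ht
  have hy := g.abs_S_sub_le_radius k ht hbar
  have hc12 := (hc _ hx).1.trans (hc _ hx).2
  rw [g.beta_eq]
  split_ifs with h
  · have h1 := g.mul_sq_le_F_sub_mul k hy hx fun x hx => (hc x hx).1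
    have h2 := g.F_sub_mul_le_mul_sq k hy hx fun x hx => (hc x hx).2
    have he : m.S k ω (m.φ k ω ⬝ᵥ t) - m.φ k ω ⬝ᵥ t -
        (m.S k ω (m.φ k ω ⬝ᵥ t) - m.φ k ω ⬝ᵥ m.thetaBar k ω) =
          m.φ k ω ⬝ᵥ (m.thetaBar k ω - t) := by rw [dotProduct_sub]; ring
    rw [he] at h1 h2
    set e := m.φ k ω ⬝ᵥ (m.thetaBar k ω - t)
    set Δ := m.F (k + 1) ω (m.S k ω (m.φ k ω ⬝ᵥ t) - m.φ k ω ⬝ᵥ t) -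
        m.F (k + 1) ω (m.S k ω (m.φ k ω ⬝ᵥ t) - m.φ k ω ⬝ᵥ m.thetaBar k ω)
    have he2 : 0 < e ^ 2 := by positivity
    have hd : Δ / e * e ^ 2 = Δ * e := by field_simp
    have h3 : c₁ ≤ Δ / e := le_of_mul_le_mul_right (by rwa [hd]) he2
    have h4 : Δ / e ≤ c₂ := le_of_mul_le_mul_right (by rwa [hd]) he2
    rw [mul_div_assoc]
    constructor <;> nlinarith
  · have := hc _ hx
    constructor <;> nlinarith

theorem radius_nonneg (k : ℕ) : 0 ≤ m.radius k ω := by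
  have := (abs_nonneg _).trans (g.le_C k m.θ g.θ_mem)
  exact le_trans (by linarith) (le_max_left _ _)

theorem betaBar_bounds (k : ℕ) {c₁ c₂ : ℝ} (hc : ∀ x, |x| ≤ m.radius k ω →
      c₁ ≤ m.f (k + 1) ω x ∧ m.f (k + 1) ω x ≤ c₂) :
    c₁ ≤ m.betaBar k ω ∧ m.betaBar k ω ≤ c₂ ∧
      ∀ x, |x| ≤ m.radius k ω → m.betaBar k ω ≤ m.f (k + 1) ω x := by
  have h0 : |(0 : ℝ)| ≤ m.radius k ω := by simpa using g.radius_nonneg k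
  have hle : ∀ x, |x| ≤ m.radius k ω → m.betaBar k ω ≤ m.f (k + 1) ω x := by
    intro x hx
    refine csInf_le ⟨c₁, ?_⟩ ⟨x, hx, rfl⟩
    rintro _ ⟨y, hy, rfl⟩
    exact (hc y hy).1
  refine ⟨le_csInf ⟨_, 0, h0, rfl⟩ ?_, (hle 0 h0).trans (hc 0 h0).2, hle⟩
  rintro _ ⟨y, hy, rfl⟩
  exact (hc y hy).1

/-- Since β̄ is below the density on the relevant interval, ψδ ≥ β̄δ². One of the two copies of ψδ
covers bβ̄δ² and the other leaves at least c₁δ². -/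
theorem prelim_drift (k : ℕ) {t : Fin d → ℝ} (ht : t ∈ m.D) {c₁ c₂ : ℝ} (hc₁ : 0 < c₁)
    (hc : ∀ x, |x| ≤ m.radius k ω → c₁ ≤ m.f (k + 1) ω x ∧ m.f (k + 1) ω x ≤ c₂) :
    c₁ * (m.φ k ω ⬝ᵥ (m.θ - t)) ^ 2 ≤ 2 * m.meanInnov k ω t * (m.φ k ω ⬝ᵥ (m.θ - t)) -
      m.b k ω * m.betaBar k ω * (m.φ k ω ⬝ᵥ (m.θ - t)) ^ 2 := by
  obtain ⟨hb1, -, hb3⟩ := g.betaBar_bounds k hc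
  have hγ := sens_mem (m := m) k ω t
  have h1 := g.mul_sq_le_F_sub_mul k (g.abs_S_sub_le_radius k ht g.θ_mem)
    (g.abs_S_sub_le_radius k ht ht) hb3
  have he : m.S k ω (m.φ k ω ⬝ᵥ t) - m.φ k ω ⬝ᵥ t -
        (m.S k ω (m.φ k ω ⬝ᵥ t) - m.φ k ω ⬝ᵥ m.θ) =
          m.φ k ω ⬝ᵥ (m.θ - t) := by rw [dotProduct_sub]; ring
  rw [he] at h1
  unfold meanInnov level
  set δ := m.φ k ω ⬝ᵥ (m.θ - t)
  set Δ := m.F (k + 1) ω (m.S k ω (m.φ k ω ⬝ᵥ t) - m.φ k ω ⬝ᵥ t) -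
        m.F (k + 1) ω (m.S k ω (m.φ k ω ⬝ᵥ t) - m.φ k ω ⬝ᵥ m.θ)
  set β := m.betaBar k ω
  have hβ : 0 ≤ β * δ ^ 2 := mul_nonneg (by linarith) (sq_nonneg _)
  have h2 : β * δ ^ 2 ≤ m.sens k ω t * (Δ * δ) := by nlinarith [hγ.1]
  have h3 : m.b k ω * (β * δ ^ 2) ≤ 1 * (β * δ ^ 2) :=
    mul_le_mul_of_nonneg_right (g.b_le k) hβ
  have h4 : c₁ * δ ^ 2 ≤ β * δ ^ 2 := mul_le_mul_of_nonneg_right hb1 (sq_nonneg _)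
  linarith

theorem accel_drift (k : ℕ) {t : Fin d → ℝ} (ht : t ∈ m.D) (hbar : m.thetaBar k ω ∈ m.D)
    {c₁ c₂ : ℝ} (hc₁ : 0 < c₁)
    (hc : ∀ x, |x| ≤ m.radius k ω → c₁ ≤ m.f (k + 1) ω x ∧ m.f (k + 1) ω x ≤ c₂) :
    c₁ / 2 * (m.φ k ω ⬝ᵥ (m.θ - t)) ^ 2
        - 8 * c₂ ^ 2 / c₁ * (m.φ k ω ⬝ᵥ (m.θ - m.thetaBar k ω)) ^ 2 ≤
      2 * m.meanInnov k ω t * (m.φ k ω ⬝ᵥ (m.θ - t)) -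
        m.b k ω * m.beta k ω t * (m.φ k ω ⬝ᵥ (m.θ - t)) ^ 2 := by
  have hz := g.abs_S_sub_le_radius k ht g.θ_mem
  have hp := g.abs_S_sub_le_radius k ht ht
  have hq := g.abs_S_sub_le_radius k ht hbar
  obtain ⟨hβ1, hβ2⟩ := g.beta_bounds k ht hbar hc₁ hc
  have h1 := g.mul_sq_le_F_sub_mul k hz hp fun x hx => (hc x hx).1
  have h2 := g.abs_F_sub_le k hq hz fun x hx => ⟨hc₁.le.trans (hc x hx).1, (hc x hx).2⟩
  have h := drift_of_slope (Hz := m.F (k + 1) ω (m.S k ω (m.φ k ω ⬝ᵥ t) - m.φ k ω ⬝ᵥ t) -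
      m.F (k + 1) ω (m.S k ω (m.φ k ω ⬝ᵥ t) - m.φ k ω ⬝ᵥ m.θ)) (z := m.φ k ω ⬝ᵥ m.θ)
    hc₁ (g.b_le k) (hc₁.le.trans hβ1) hβ2 (sens_mem k ω t) (g.beta_mul_eq k t)
    (by rwa [sub_sub_sub_cancel_left] at h1)
    (by rw [sub_sub_sub_cancel_left] at h2; rwa [sub_sub_sub_cancel_left])
  rw [dotProduct_sub, dotProduct_sub, meanInnov, level,
    show (m.φ k ω ⬝ᵥ m.θ - m.φ k ω ⬝ᵥ m.thetaBar k ω) ^ 2 =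
      (m.φ k ω ⬝ᵥ m.thetaBar k ω - m.φ k ω ⬝ᵥ m.θ) ^ 2 by ring]
  exact h

/-- Serves both recursions: q is 0 for the preliminary one and the preliminary prediction error for
the accelerated one. -/
theorem sum_sq_le_of_recursion {s : ℕ → (Fin d → ℝ) × Matrix (Fin d) (Fin d) ℝ} {μ β : ℕ → ℝ}
    (hs : ∀ k, s (k + 1) = m.step k ω (μ k) (β k) (s k)) (h0 : (s 0).2.PosDef)
    {μ₁ μ₂ β₁ κ K : ℝ} (hμ₁ : 0 < μ₁) (hμ : ∀ k, μ₁ ≤ μ k ∧ μ k ≤ μ₂) (hβ₁ : 0 < β₁)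
    (hβ : ∀ k, β₁ ≤ β k) (hne : ∀ k, m.ε (k + 1) ω ≠ m.level k ω (s k).1)
    (hκ : 0 < κ) (hK : 0 ≤ K) {q : ℕ → ℝ}
    (hdrift : ∀ k, κ * (m.φ k ω ⬝ᵥ (m.θ - (s k).1)) ^ 2 - K * q k ^ 2 ≤
      2 * m.meanInnov k ω (s k).1 * (m.φ k ω ⬝ᵥ (m.θ - (s k).1)) -
        m.b k ω * β k * (m.φ k ω ⬝ᵥ (m.θ - (s k).1)) ^ 2)
    (hmart : ∀ η : ℝ, 0 < η → ∃ K' : ℝ, ∀ n, ∑ k ∈ Finset.range n,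
        (-2 * (m.b k ω / μ k) * m.sens k ω (s k).1 * (m.φ k ω ⬝ᵥ (m.θ - (s k).1))) *
          m.noiseDev k ω (s k).1 ≤
      η * ∑ k ∈ Finset.range n,
        (-2 * (m.b k ω / μ k) * m.sens k ω (s k).1 * (m.φ k ω ⬝ᵥ (m.θ - (s k).1))) ^ 2 + K') :
    ∃ A B : ℝ, 0 ≤ A ∧ 0 ≤ B ∧ ∀ n, ∑ k ∈ Finset.range n, (m.φ k ω ⬝ᵥ (m.θ - (s k).1)) ^ 2 ≤
      A + B * (Real.log (s n).2⁻¹.det - Real.log (s 0).2⁻¹.det)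
        + B * ∑ k ∈ Finset.range n, q k ^ 2 := by
  have hμ0 : ∀ k, 0 < μ k := fun k => hμ₁.trans_le (hμ k).1
  have hβ0 : ∀ k, 0 < β k := fun k => hβ₁.trans_le (hβ k)
  have hs2 : ∀ k, (s (k + 1)).2 = gainUpdate (s k).2 (m.φ k ω) (μ k) (β k) (m.b k ω) := by
    intro k; rw [hs k]; rfl
  have hP : ∀ k, (s k).2.PosDef := by
    intro k
    induction k with
    | zero => exact h0
    | succ k ih => rw [hs2]; exact posDef_gainUpdate ih _ _ (hμ0 k) (hβ0 k)
  obtain ⟨c, hc, hbc⟩ := g.b_lower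
  refine sum_sq_le_of_energy (V := fun k => (m.θ - (s k).1) ⬝ᵥ ((s k).2⁻¹ *ᵥ (m.θ - (s k).1)))
    (Λ := fun k => Real.log (s k).2⁻¹.det) (v := fun k => m.innov k ω (s k).1)
    (fun k => PosDef.dotProduct_mulVec_self_nonneg (hP k).inv _)
    (monotone_nat_of_le_succ fun k => ?_) (fun k => ?_) hβ₁ hβ hμ₁ hμ hc
    (fun k => ⟨hbc k, g.b_le k⟩) (fun k => g.innov_eq k _ (hne k))
    (fun k => g.abs_innov_le k _ (hne k))
    (fun k => ⟨by linarith [(sens_mem (m := m) k ω (s k).1).1], (sens_mem k ω _).2⟩)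
    hκ hK hdrift hmart
  · rw [hs2]
    exact log_det_inv_gainUpdate_ge (hP k) _ _ (hμ0 k) (hβ0 k)
  · have := energy_step g.compact_D g.convex_D g.θ_mem (hP k) (m.φ k ω) (s k).1 (m.b k ω)
      (m.innov k ω (s k).1) (hμ0 k) (hβ0 k) (t' := (s (k + 1)).1) (by rw [hs k]; rfl)
    rw [← hs2] at this
    exact this

theorem recursion_mem {s : ℕ → (Fin d → ℝ) × Matrix (Fin d) (Fin d) ℝ} {μ β : ℕ → ℝ}
    (hs : ∀ k, s (k + 1) = m.step k ω (μ k) (β k) (s k)) (h0 : (s 0).1 ∈ m.D) (k : ℕ) :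
    (s k).1 ∈ m.D := by
  cases k with
  | zero => exact h0
  | succ k => rw [hs k]; exact (proj_spec g.compact_D ⟨_, g.θ_mem⟩ _ _).1

end GoodPath

/-! ### Growth of the information matrix and the averaged regret -/

theorem recursion_inv {s : ℕ → (Fin d → ℝ) × Matrix (Fin d) (Fin d) ℝ} {μ β : ℕ → ℝ}
    (hs : ∀ k, s (k + 1) = m.step k ω (μ k) (β k) (s k)) (h0 : (s 0).2.PosDef)
    (hμ : ∀ k, 0 < μ k) (hβ : ∀ k, 0 < β k) (n : ℕ) : (s n).2.PosDef ∧
      (s n).2⁻¹ = (s 0).2⁻¹ + ∑ k ∈ Finset.range n,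
        (β k * m.b k ω ^ 2 / μ k) • vecMulVec (m.φ k ω) (m.φ k ω) := by
  induction n with
  | zero => simpa using h0
  | succ n ih =>
    have hs2 : (s (n + 1)).2 = gainUpdate (s n).2 (m.φ n ω) (μ n) (β n) (m.b n ω) := by
      rw [hs n]; rfl
    rw [hs2]
    refine ⟨posDef_gainUpdate ih.1 _ _ (hμ n) (hβ n), ?_⟩
    rw [inv_gainUpdate ih.1 _ _ (hμ n) (hβ n), ih.2, Finset.sum_range_succ, add_assoc]

theorem isHermitian_sum_vecMulVec (h0 : (m.P₀ ω).PosDef) (n : ℕ) : ((m.P₀ ω)⁻¹ +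
    ∑ i ∈ Finset.range n, vecMulVec (m.φ i ω) (m.φ i ω)).PosDef :=
  h0.inv.add_posSemidef (posSemidef_sum _ fun _ _ => posSemidef_vecMulVec_self _)

theorem infoMax_mono (hd : 1 ≤ d) (h0 : (m.P₀ ω).PosDef) : Monotone fun n => m.infoMax n ω := by
  refine monotone_nat_of_le_succ fun n => ?_
  unfold infoMax
  rw [Finset.sum_range_succ _ (n + 1), ← add_assoc]
  exact lambdaMax_le_add hd (isHermitian_sum_vecMulVec h0 _).1 (posSemidef_vecMulVec_self _)

/-- The nonnegative trace of P₀⁻¹ is dropped, so the bound also serves the preliminary recursion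
with its own initial gain. -/
theorem sum_dotProduct_self_le (h0 : (m.P₀ ω).PosDef) (n : ℕ) :
    ∑ i ∈ Finset.range (n + 1), m.φ i ω ⬝ᵥ m.φ i ω ≤ d * m.infoMax n ω := by
  have h := trace_le_lambdaMax (isHermitian_sum_vecMulVec h0 (n + 1)).1
  rw [trace_add, trace_sum] at h
  simp only [trace_vecMulVec] at h
  have h2 : 0 ≤ (m.P₀ ω)⁻¹.trace := h0.inv.posSemidef.trace_nonneg
  exact le_trans (by linarith) h

/-- The log-determinant of the information matrix grows at most like `log λ_max`. -/
theorem GoodPath.log_det_le (g : m.GoodPath ω) (hd : 1 ≤ d) (hP₀ : (m.P₀ ω).PosDef)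
    {s : ℕ → (Fin d → ℝ) × Matrix (Fin d) (Fin d) ℝ} {μ β : ℕ → ℝ}
    (hs : ∀ k, s (k + 1) = m.step k ω (μ k) (β k) (s k)) (h0 : (s 0).2.PosDef)
    {μ₁ β₂ : ℝ} (hμ₁ : 0 < μ₁) (hμ : ∀ k, μ₁ ≤ μ k) (hβ : ∀ k, 0 < β k ∧ β k ≤ β₂) :
    ∃ A : ℝ, 0 ≤ A ∧ ∀ n, 1 ≤ m.infoMax n ω →
      Real.log (s (n + 1)).2⁻¹.det ≤ A + d * Real.log (m.infoMax n ω) := by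
  obtain ⟨c, hc, hbc⟩ := g.b_lower
  have hβ₂ : 0 < β₂ := (hβ 0).1.trans_le (hβ 0).2
  set T := (s 0).2⁻¹.trace with hT
  have : Nonempty (Fin d) := ⟨⟨0, hd⟩⟩
  have hT0 : 0 < T := h0.inv.trace_pos
  set r := β₂ / μ₁ with hr
  have hr0 : 0 < r := by positivity
  have hd0 : (0 : ℝ) < d := by exact_mod_cast hd
  refine ⟨d * |Real.log (T + r * d)|, by positivity, fun n hn => ?_⟩
  obtain ⟨hpd, hinv⟩ := recursion_inv hs h0 (fun k => hμ₁.trans_le (hμ k)) (fun k => (hβ k).1)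
    (n + 1)
  -- The initial trace T is absorbed because λ_max(n) ≥ 1. The sum up to index n in λ_max(n) matches
  -- the gain at time n + 1.
  have htr : (s (n + 1)).2⁻¹.trace ≤ (T + r * d) * m.infoMax n ω := by
    rw [hinv, trace_add, trace_sum]
    simp only [trace_smul, trace_vecMulVec, smul_eq_mul]
    have h1 : ∑ k ∈ Finset.range (n + 1),
        β k * m.b k ω ^ 2 / μ k * (m.φ k ω ⬝ᵥ m.φ k ω) ≤
        ∑ k ∈ Finset.range (n + 1), r * (m.φ k ω ⬝ᵥ m.φ k ω) := by
      refine Finset.sum_le_sum fun k _ => mul_le_mul_of_nonneg_right ?_ ?_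
      · have hb2 : m.b k ω ^ 2 ≤ 1 := pow_le_one₀ (hc.le.trans (hbc k)) (g.b_le k)
        refine div_le_div₀ hβ₂.le ?_ hμ₁ (hμ k)
        calc β k * m.b k ω ^ 2 ≤ β₂ * 1 :=
              mul_le_mul (hβ k).2 hb2 (sq_nonneg _) hβ₂.le
          _ = β₂ := mul_one _
      · simpa using dotProduct_star_self_nonneg (m.φ k ω)
    rw [← Finset.mul_sum] at h1
    have h2 := mul_le_mul_of_nonneg_left (sum_dotProduct_self_le (m := m) hP₀ n) hr0.le
    have h3 : T * 1 ≤ T * m.infoMax n ω := mul_le_mul_of_nonneg_left hn hT0.le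
    linarith
  have hlog := Real.log_le_log hpd.inv.trace_pos htr
  rw [Real.log_mul (by positivity) (by linarith)] at hlog
  have h4 := mul_le_mul_of_nonneg_left hlog hd0.le
  have h5 := mul_le_mul_of_nonneg_left (le_abs_self (Real.log (T + r * d))) hd0.le
  have h6 := log_det_le_log_trace hpd.inv
  linarith

theorem GoodPath.regret_le (g : m.GoodPath ω) (k : ℕ) :
    m.regret k ω ≤ |m.φ k ω ⬝ᵥ (m.θ - m.theta k ω)| := by
  obtain ⟨c, hc, hbc⟩ := g.b_lower
  unfold regret
  rw [g.S_eq, g.S_eq, dotProduct_sub]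
  calc _ ≤ 1 * |m.φ k ω ⬝ᵥ m.θ - m.φ k ω ⬝ᵥ m.theta k ω| :=
        mul_le_mul (g.b_le k) (abs_sat_sub_sat_le (g.lower_lt_upper k).le) (abs_nonneg _) zero_le_one
    _ = _ := one_mul _

theorem GoodPath.regret_nonneg (g : m.GoodPath ω) (k : ℕ) : 0 ≤ m.regret k ω := by
  obtain ⟨c, hc, hbc⟩ := g.b_lower
  exact mul_nonneg (hc.le.trans (hbc k)) (abs_nonneg _)

/-- The averaged regret is controlled by a logarithmic bound of the squared prediction errors. -/
theorem GoodPath.averaged_regret_isBigO (g : m.GoodPath ω) {K : ℝ} {n₀ : ℕ} (hK : 0 ≤ K)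
    (h : ∀ n, n₀ ≤ n → ∑ k ∈ Finset.range (n + 1), (m.φ k ω ⬝ᵥ (m.θ - m.theta k ω)) ^ 2 ≤
      K * Real.log (m.infoMax n ω)) :
    (fun n : ℕ => (1 / (n : ℝ)) * ∑ k ∈ Finset.Icc 1 n, m.regret k ω)
      =O[atTop] (fun n : ℕ => Real.sqrt (Real.log (m.infoMax n ω) / (n : ℝ))) := by
  refine Asymptotics.IsBigO.of_bound (Real.sqrt K) ?_
  filter_upwards [eventually_ge_atTop n₀, eventually_ge_atTop 1] with n hn hn1
  have hn0 : (0 : ℝ) < n := by exact_mod_cast hn1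
  have hnn : 0 ≤ ∑ k ∈ Finset.Icc 1 n, m.regret k ω :=
    Finset.sum_nonneg fun k _ => g.regret_nonneg k
  rw [Real.norm_eq_abs, Real.norm_eq_abs, abs_of_nonneg (by positivity),
    abs_of_nonneg (Real.sqrt_nonneg _), ← Real.sqrt_mul hK]
  apply Real.le_sqrt_of_sq_le
  have hcs : (∑ k ∈ Finset.Icc 1 n, m.regret k ω) ^ 2 ≤
      n * ∑ k ∈ Finset.Icc 1 n, m.regret k ω ^ 2 := by
    simpa using sq_sum_le_card_mul_sum_sq (s := Finset.Icc 1 n) (f := fun k => m.regret k ω)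
  have hsq : ∑ k ∈ Finset.Icc 1 n, m.regret k ω ^ 2 ≤
      ∑ k ∈ Finset.range (n + 1), (m.φ k ω ⬝ᵥ (m.θ - m.theta k ω)) ^ 2 := by
    calc ∑ k ∈ Finset.Icc 1 n, m.regret k ω ^ 2 ≤
          ∑ k ∈ Finset.Icc 1 n, (m.φ k ω ⬝ᵥ (m.θ - m.theta k ω)) ^ 2 :=
          Finset.sum_le_sum fun k _ => by
            rw [← sq_abs (_ ⬝ᵥ _)]
            exact pow_le_pow_left₀ (g.regret_nonneg k) (g.regret_le k) 2
      _ ≤ _ := Finset.sum_le_sum_of_subset_of_nonneg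
          (fun k hk => by
            have := Finset.mem_Icc.1 hk
            exact Finset.mem_range.2 (by omega)) fun _ _ _ => sq_nonneg _
  have h1 := h n hn
  calc (1 / (n : ℝ) * ∑ k ∈ Finset.Icc 1 n, m.regret k ω) ^ 2
      = (1 / (n : ℝ)) ^ 2 * (∑ k ∈ Finset.Icc 1 n, m.regret k ω) ^ 2 := by ring
    _ ≤ (1 / (n : ℝ)) ^ 2 * (n * (K * Real.log (m.infoMax n ω))) := by
        gcongr
        exact hcs.trans (mul_le_mul_of_nonneg_left (hsq.trans h1) hn0.le)
    _ = K * (Real.log (m.infoMax n ω) / n) := by field_simp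

end Model

end TSWLAD

namespace TSWLAD

/-! ### Measurability of the algebraic operations -/

section MeasurableOperations

variable {Ω : Type*} {m₀ : MeasurableSpace Ω} {d : ℕ}

theorem measurable_dotProduct {x y : Ω → Fin d → ℝ} (hx : Measurable x) (hy : Measurable y) :
    Measurable fun ω => x ω ⬝ᵥ y ω :=
  Finset.measurable_fun_sum _ fun i _ =>
    ((measurable_pi_apply i).comp hx).mul ((measurable_pi_apply i).comp hy)

theorem measurable_sat {l u L U x : Ω → ℝ} (hl : Measurable l) (hu : Measurable u)
    (hL : Measurable L) (hU : Measurable U) (hx : Measurable x) :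
    Measurable fun ω => sat (l ω) (u ω) (L ω) (U ω) (x ω) :=
  Measurable.ite (measurableSet_lt hx hl) hL (Measurable.ite (measurableSet_le hx hu) hx hU)

theorem measurable_sign {x : Ω → ℝ} (hx : Measurable x) : Measurable fun ω => Real.sign (x ω) :=
  Measurable.ite (measurableSet_lt hx measurable_const) measurable_const
    (Measurable.ite (measurableSet_lt measurable_const hx) measurable_const measurable_const)

theorem measurable_ite_eq {x y a b : Ω → ℝ} [∀ ω, Decidable (x ω = y ω)] (hx : Measurable x)
    (hy : Measurable y) (ha : Measurable a) (hb : Measurable b) :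
    Measurable fun ω => if x ω = y ω then a ω else b ω :=
  Measurable.ite (measurableSet_eq_fun hx hy) ha hb

theorem continuous_of : Continuous (Matrix.of : (Fin d → Fin d → ℝ) → Matrix (Fin d) (Fin d) ℝ) :=
  continuous_matrix fun i j => (continuous_apply j).comp (continuous_apply i)

theorem measurable_comp_entries {P : Ω → Matrix (Fin d) (Fin d) ℝ}
    (hP : ∀ i j, Measurable fun ω => P ω i j) {h : Matrix (Fin d) (Fin d) ℝ → ℝ}
    (hh : Continuous h) : Measurable fun ω => h (P ω) := by
  have h0 : Continuous fun A : Fin d → Fin d → ℝ => h (Matrix.of A) :=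
    hh.comp continuous_of
  have h1 : Measurable fun A : Fin d → Fin d → ℝ => h (Matrix.of A) := h0.measurable
  have h2 : Measurable fun ω => (fun i j => P ω i j : Fin d → Fin d → ℝ) :=
    measurable_pi_lambda _ fun i => measurable_pi_lambda _ fun j => hP i j
  exact h1.comp h2

theorem measurable_mulVec {P : Ω → Matrix (Fin d) (Fin d) ℝ}
    (hP : ∀ i j, Measurable fun ω => P ω i j) {x : Ω → Fin d → ℝ} (hx : Measurable x) :
    Measurable fun ω => P ω *ᵥ x ω :=
  measurable_pi_lambda _ fun i =>
    measurable_dotProduct (x := fun ω => P ω i) (measurable_pi_lambda _ fun j => hP i j) hx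

theorem measurable_inv_entries {P : Ω → Matrix (Fin d) (Fin d) ℝ}
    (hP : ∀ i j, Measurable fun ω => P ω i j) (i j : Fin d) :
    Measurable fun ω => (P ω)⁻¹ i j := by
  simp only [inv_def, Matrix.smul_apply, Ring.inverse_eq_inv', smul_eq_mul]
  exact (measurable_comp_entries hP (continuous_id.matrix_det)).inv.mul
    (measurable_comp_entries hP (h := fun A => A.adjugate i j)
      (continuous_id.matrix_adjugate.matrix_elem i j))

theorem measurable_gainUpdate_entries {P : Ω → Matrix (Fin d) (Fin d) ℝ}
    (hP : ∀ i j, Measurable fun ω => P ω i j) {φ : Ω → Fin d → ℝ} (hφ : Measurable φ)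
    {μ β b : Ω → ℝ} (hμ : Measurable μ) (hβ : Measurable β) (hb : Measurable b) (i j : Fin d) :
    Measurable fun ω => gainUpdate (P ω) (φ ω) (μ ω) (β ω) (b ω) i j := by
  have hφi : ∀ i, Measurable fun ω => φ ω i := fun i => (measurable_pi_apply i).comp hφ
  have hs := measurable_dotProduct hφ (measurable_mulVec hP hφ)
  have hden : Measurable fun ω => μ ω + β ω * b ω ^ 2 * (φ ω ⬝ᵥ (P ω *ᵥ φ ω)) :=
    hμ.add ((hβ.mul (hb.pow_const 2)).mul hs)
  simp only [gainUpdate, Matrix.sub_apply, Matrix.smul_apply, smul_eq_mul, mul_apply, vecMulVec_apply]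
  refine (hP i j).sub ((((measurable_const.div hden).mul hβ).mul (hb.pow_const 2)).mul ?_)
  refine Finset.measurable_fun_sum _ fun a _ => Measurable.mul ?_ (hP a j)
  exact Finset.measurable_fun_sum _ fun c _ => (hP i c).mul ((hφi c).mul (hφi a))

theorem measurable_proj {D : Set (Fin d → ℝ)} (hD : IsCompact D) (hne : D.Nonempty)
    (hconv : Convex ℝ D) {Q : Ω → Matrix (Fin d) (Fin d) ℝ} (hpd : ∀ ω, (Q ω).PosDef)
    (hQ : ∀ i j, Measurable fun ω => Q ω i j) {x : Ω → Fin d → ℝ} (hx : Measurable x) :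
    Measurable fun ω => proj D (Q ω) (x ω) := by
  have hval : Continuous fun a : {A : Fin d → Fin d → ℝ // (Matrix.of A).PosDef} × (Fin d → ℝ) =>
      Matrix.of a.1.1 :=
    continuous_of.comp (continuous_subtype_val.comp continuous_fst)
  have hι : Continuous fun a : {A : Fin d → Fin d → ℝ // (Matrix.of A).PosDef} × (Fin d → ℝ) =>
      ((⟨Matrix.of a.1.1, a.1.2⟩ : {A : Matrix (Fin d) (Fin d) ℝ // A.PosDef}), a.2) :=
    (hval.subtype_mk fun a => a.1.2).prodMk continuous_snd
  have hc : Continuous fun a : {A : Fin d → Fin d → ℝ // (Matrix.of A).PosDef} × (Fin d → ℝ) =>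
      proj D (Matrix.of a.1.1) a.2 := (continuous_proj_posDef hD hne hconv).comp hι
  have h2 : Measurable fun ω => (⟨fun i j => Q ω i j, hpd ω⟩ :
      {A : Fin d → Fin d → ℝ // (Matrix.of A).PosDef}) :=
    Measurable.subtype_mk
      (measurable_pi_lambda _ fun i => measurable_pi_lambda _ fun j => hQ i j)
  have h3 := hc.measurable
  have h4 := h2.prodMk hx
  have h5 := h3.comp h4
  exact h5

theorem measurable_completed_proj {Ω : Type*} {m mΩ : MeasurableSpace Ω} {μ : Measure[mΩ] Ω}
    {D : Set (Fin d → ℝ)} (hD : IsCompact D) (hne : D.Nonempty)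
    (hconv : Convex ℝ D) {Q : Ω → Matrix (Fin d) (Fin d) ℝ} (hpd : ∀ᵐ ω ∂μ, (Q ω).PosDef)
    (hQ : ∀ i j, Measurable[completed m μ] fun ω => Q ω i j) {x : Ω → Fin d → ℝ}
    (hx : Measurable[completed m μ] x) :
    Measurable[completed m μ] fun ω => proj D (Q ω) (x ω) := by
  classical
  set Q' : Ω → Matrix (Fin d) (Fin d) ℝ := fun ω => if (Q ω).PosDef then Q ω else 1 with hQ'
  have heq : ∀ᵐ ω ∂μ, Q ω = Q' ω := by
    filter_upwards [hpd] with ω hω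
    simp [hQ', hω]
  have hpd' : ∀ ω, (Q' ω).PosDef := by
    intro ω
    by_cases h : (Q ω).PosDef
    · simp [hQ', h]
    · simp [hQ', h, PosDef.one]
  have h := measurable_proj hD hne hconv hpd' (m₀ := completed m μ)
    (fun i j => (hQ i j).congr_completed (by filter_upwards [heq] with ω hω; rw [hω])) hx
  exact h.congr_completed (by filter_upwards [heq] with ω hω; rw [hω])

/-- Clipped rationals are dense in [-R, R]. When R is random, this turns an infimum over a moving
interval into a countable one. -/
theorem sInf_image_abs_le_eq_iInf {f : ℝ → ℝ} (hf : Continuous f) {R c : ℝ} (hR : 0 ≤ R)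
    (hc : ∀ x, |x| ≤ R → c ≤ f x) :
    sInf (f '' {x : ℝ | |x| ≤ R}) = ⨅ q : ℚ, f (max (-R) (min (q : ℝ) R)) := by
  have hclip : ∀ x : ℝ, |max (-R) (min x R)| ≤ R := fun x =>
    abs_le.2 ⟨le_max_left _ _, max_le (by linarith) (min_le_right _ _)⟩
  have hbdd : BddBelow (Set.range fun q : ℚ => f (max (-R) (min (q : ℝ) R))) := by
    refine ⟨c, ?_⟩
    rintro _ ⟨q, rfl⟩
    exact hc _ (hclip _)
  refine le_antisymm (le_ciInf fun q => csInf_le ⟨c, ?_⟩ ⟨_, hclip q, rfl⟩)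
    (le_csInf ⟨_, 0, by simpa using hR, rfl⟩ ?_)
  · rintro _ ⟨x, hx, rfl⟩
    exact hc x hx
  · rintro _ ⟨x, hx : |x| ≤ R, rfl⟩
    have h : ∀ x : ℝ, (⨅ q : ℚ, f (max (-R) (min (q : ℝ) R))) ≤ f (max (-R) (min x R)) := by
      intro x
      refine (Rat.isDenseEmbedding_coe_real.dense).induction_on x
        (isClosed_le continuous_const (by fun_prop)) fun q => ciInf_le hbdd q
    have hx' := abs_le.1 hx
    simpa [min_eq_left hx'.2, max_eq_right hx'.1] using h x

end MeasurableOperations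

/-! ### Almost every path is good -/

namespace Model

variable {Ω : Type*} [mΩ : MeasurableSpace Ω] {ℙ : Measure Ω} [IsProbabilityMeasure ℙ]
  {ℱ : Filtration ℕ mΩ} {d : ℕ} {m : Model Ω d} {M : ℝ}

/-- The conditional distribution identity has a null set for each x, so it is used at integers only;
monotonicity, from the density, covers the rest. -/
theorem ae_F_le_one (h₃ : m.NoiseAssumption ℱ ℙ M) : ∀ᵐ ω ∂ℙ, ∀ k x, m.F (k + 1) ω x ≤ 1 := by
  have h : ∀ᵐ ω ∂ℙ, ∀ k (n : ℕ), m.F (k + 1) ω n ≤ 1 := by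
    refine ae_all_iff.2 fun k => ae_all_iff.2 fun n => ?_
    have h1 : ℙ[Set.indicator {ω | m.ε (k + 1) ω ≤ (n : ℝ)} (fun _ => (1 : ℝ)) | ℱ k] ≤ᵐ[ℙ]
        ℙ[fun _ => (1 : ℝ) | ℱ k] :=
      condExp_mono ((integrable_const _).indicator
        (measurableSet_le (h₃.measurable_ε k) measurable_const)) (integrable_const _)
        (Eventually.of_forall fun ω => Set.indicator_le_self' (by simp) ω)
    rw [condExp_const (ℱ.le k)] at h1
    filter_upwards [h1, h₃.condCDF k n] with ω h1 h2
    rw [h2]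
    exact h1
  filter_upwards [h, h₃.density] with ω h hd k x
  obtain ⟨n, hn⟩ := exists_nat_ge x
  refine le_trans ?_ (h k n)
  obtain ⟨-, hf0, hfi, hF⟩ := hd k
  rw [hF, hF]
  exact setIntegral_mono_set hfi.integrableOn (Eventually.of_forall hf0)
    (Eventually.of_forall fun y hy => le_trans hy hn)

theorem ae_goodPath (h₁ : m.RegressorAssumption ℱ ℙ) (h₂ : m.ThresholdAssumption ℱ ℙ M)
    (h₃ : m.NoiseAssumption ℱ ℙ M)
    (hcont : ∀ᵐ ω ∂ℙ, ∀ k, m.l k ω = m.L k ω ∧ m.u k ω = m.U k ω) :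
    ∀ᵐ ω ∂ℙ, m.GoodPath ω := by
  obtain ⟨C, hC, hbd⟩ := h₃.density_bounds
  filter_upwards [h₁.le_C, h₂.ordered, h₂.le_M, h₂.nondegenerate, h₂.b_bounds, h₃.density,
    h₃.median, hcont, hC, hbd, ae_F_le_one h₃] with ω hle hord hM hnd hb hden hmed hcont hC hbd hF1
  refine ⟨h₁.compact_D, h₁.convex_D, interior_subset h₁.θ_mem, fun k => (hcont k).1,
    fun k => (hcont k).2, fun k => ?_, hle, hb.1, hb.2, fun k => (hden k).1, fun k x y => ?_,
    fun k x => ⟨?_, hF1 k x⟩, hmed, ?_⟩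
  -- With continuous saturation, l = u is exactly the excluded degenerate case.
  · refine lt_of_le_of_ne (hord k).2.1 fun h => hnd k ⟨(hcont k).1.symm, h, (hcont k).2⟩
  · obtain ⟨-, -, hfi, hF⟩ := hden k
    rw [hF, hF]
    exact intervalIntegral.integral_Iic_sub_Iic hfi.integrableOn hfi.integrableOn
  · rw [(hden k).2.2.2]
    exact integral_nonneg (hden k).2.1
  · obtain ⟨c₁, c₂, hc₁, hc⟩ := hbd
    refine ⟨c₁, c₂, hc₁, fun k x hx => hc k x (hx.trans ?_)⟩
    have hMk := max_le_iff.1 (hM k)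
    have hCk := hC k
    refine max_le (le_max_of_le_left (by linarith)) (le_max_of_le_right (max_le ?_ ?_)) <;> linarith

end Model

end TSWLAD

namespace TSWLAD

namespace Model

/-! ### Adaptedness of the estimates -/

section Adapted

variable {Ω : Type*} [mΩ : MeasurableSpace Ω] {ℙ : Measure Ω}
  {ℱ : Filtration ℕ mΩ} {d : ℕ} {m : Model Ω d} {M : ℝ}

theorem measurable_F_comp (h₃ : m.NoiseAssumption ℱ ℙ M) (hg : ∀ᵐ ω ∂ℙ, m.GoodPath ω) (k : ℕ)
    {X : Ω → ℝ} (hX : Measurable[completed (ℱ k) ℙ] X) :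
    Measurable[completed (ℱ k) ℙ] fun ω => m.F (k + 1) ω (X ω) :=
  measurable_completed_comp_of_continuous (h₃.measurable_F k)
    (hg.mono fun _ g => g.continuous_F k) hX

theorem measurable_f_comp (h₃ : m.NoiseAssumption ℱ ℙ M) (hg : ∀ᵐ ω ∂ℙ, m.GoodPath ω) (k : ℕ)
    {X : Ω → ℝ} (hX : Measurable[completed (ℱ k) ℙ] X) :
    Measurable[completed (ℱ k) ℙ] fun ω => m.f (k + 1) ω (X ω) :=
  measurable_completed_comp_of_continuous (h₃.measurable_f k) (hg.mono fun _ g => g.f_cont k) hX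

theorem measurable_dot (h₁ : m.RegressorAssumption ℱ ℙ) (k : ℕ) {t : Ω → Fin d → ℝ}
    (ht : Measurable[completed (ℱ k) ℙ] t) :
    Measurable[completed (ℱ k) ℙ] fun ω => m.φ k ω ⬝ᵥ t ω :=
  measurable_dotProduct ((h₁.measurable_φ k).mono (le_completed _ ℙ) le_rfl) ht

theorem measurable_S (h₂ : m.ThresholdAssumption ℱ ℙ M) (k : ℕ) {x : Ω → ℝ}
    (hx : Measurable[completed (ℱ k) ℙ] x) :
    Measurable[completed (ℱ k) ℙ] fun ω => m.S k ω (x ω) :=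
  measurable_sat ((h₂.measurable_l k).mono (le_completed _ ℙ) le_rfl)
    ((h₂.measurable_u k).mono (le_completed _ ℙ) le_rfl)
    ((h₂.measurable_L k).mono (le_completed _ ℙ) le_rfl)
    ((h₂.measurable_U k).mono (le_completed _ ℙ) le_rfl) hx

theorem measurable_innov (h₁ : m.RegressorAssumption ℱ ℙ) (h₂ : m.ThresholdAssumption ℱ ℙ M)
    (h₃ : m.NoiseAssumption ℱ ℙ M) (hg : ∀ᵐ ω ∂ℙ, m.GoodPath ω) (k : ℕ) {t : Ω → Fin d → ℝ}
    (ht : Measurable[completed (ℱ k) ℙ] t) :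
    Measurable[completed (ℱ (k + 1)) ℙ] fun ω => m.innov k ω (t ω) := by
  have hle : completed (ℱ k) ℙ ≤ completed (ℱ (k + 1)) ℙ :=
    completed_mono (ℱ.mono k.le_succ)
  have hp := measurable_dot h₁ k ht
  have hS := measurable_S h₂ k hp
  have hFu := measurable_F_comp h₃ hg k
    (((h₂.measurable_u k).mono (le_completed _ ℙ) le_rfl).sub hp)
  have hFl := measurable_F_comp h₃ hg k
    (((h₂.measurable_l k).mono (le_completed _ ℙ) le_rfl).sub hp)
  have hy : Measurable[completed (ℱ (k + 1)) ℙ] (m.obs k) :=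
    (h₃.measurable_obs k).mono (le_completed _ ℙ) le_rfl
  have h4 := measurable_sign (hy.sub (hS.mono hle le_rfl))
  have h5 := measurable_ite_eq hS ((h₂.measurable_U k).mono (le_completed _ ℙ) le_rfl) hFu
    (@measurable_const _ _ _ (completed (ℱ k) ℙ) (0 : ℝ))
  have h6 := measurable_ite_eq hS ((h₂.measurable_L k).mono (le_completed _ ℙ) le_rfl)
    ((@measurable_const _ _ _ (completed (ℱ k) ℙ) (1 : ℝ)).sub hFl)
    (@measurable_const _ _ _ (completed (ℱ k) ℙ) (0 : ℝ))
  exact (h4.add (h5.mono hle le_rfl)).sub (h6.mono hle le_rfl)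

theorem measurable_sens (h₁ : m.RegressorAssumption ℱ ℙ) (h₂ : m.ThresholdAssumption ℱ ℙ M)
    (k : ℕ) {t : Ω → Fin d → ℝ} (ht : Measurable[completed (ℱ k) ℙ] t) :
    Measurable[completed (ℱ k) ℙ] fun ω => m.sens k ω (t ω) := by
  have hS := measurable_S h₂ k (measurable_dot h₁ k ht)
  have hL := (h₂.measurable_L k).mono (le_completed _ ℙ) le_rfl
  have hU := (h₂.measurable_U k).mono (le_completed _ ℙ) le_rfl
  refine Measurable.ite (MeasurableSet.union (?_ : MeasurableSet[completed (ℱ k) ℙ]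
    {ω | m.S k ω (m.φ k ω ⬝ᵥ t ω) = m.L k ω}) (?_ : MeasurableSet[completed (ℱ k) ℙ]
    {ω | m.S k ω (m.φ k ω ⬝ᵥ t ω) = m.U k ω})) measurable_const measurable_const
  · exact measurableSet_eq_fun hS hL
  · exact measurableSet_eq_fun hS hU

theorem measurable_level (h₁ : m.RegressorAssumption ℱ ℙ) (h₂ : m.ThresholdAssumption ℱ ℙ M)
    (k : ℕ) {t : Ω → Fin d → ℝ} (ht : Measurable[completed (ℱ k) ℙ] t) :
    Measurable[completed (ℱ k) ℙ] fun ω => m.level k ω (t ω) :=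
  (measurable_S h₂ k (measurable_dot h₁ k ht)).sub (measurable_dot h₁ k measurable_const)

theorem measurable_meanInnov (h₁ : m.RegressorAssumption ℱ ℙ)
    (h₂ : m.ThresholdAssumption ℱ ℙ M) (h₃ : m.NoiseAssumption ℱ ℙ M)
    (hg : ∀ᵐ ω ∂ℙ, m.GoodPath ω) (k : ℕ) {t : Ω → Fin d → ℝ}
    (ht : Measurable[completed (ℱ k) ℙ] t) :
    Measurable[completed (ℱ k) ℙ] fun ω => m.meanInnov k ω (t ω) :=
  (measurable_sens h₁ h₂ k ht).mul ((measurable_F_comp h₃ hg k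
    ((measurable_S h₂ k (measurable_dot h₁ k ht)).sub (measurable_dot h₁ k ht))).sub
    (measurable_F_comp h₃ hg k (measurable_level h₁ h₂ k ht)))

theorem measurable_betaBar (h₁ : m.RegressorAssumption ℱ ℙ) (h₂ : m.ThresholdAssumption ℱ ℙ M)
    (h₃ : m.NoiseAssumption ℱ ℙ M) (hg : ∀ᵐ ω ∂ℙ, m.GoodPath ω) (k : ℕ) :
    Measurable[completed (ℱ k) ℙ] (m.betaBar k) := by
  have hC := (h₁.measurable_C k).mono (le_completed _ ℙ) le_rfl
  have hl := (h₂.measurable_l k).mono (le_completed _ ℙ) le_rfl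
  have hu := (h₂.measurable_u k).mono (le_completed _ ℙ) le_rfl
  have hR : Measurable[completed (ℱ k) ℙ] (m.radius k) :=
    (hC.const_mul 2).max ((hC.add hl).max (hC.sub hu))
  have h : Measurable[completed (ℱ k) ℙ] fun ω => ⨅ q : ℚ,
      m.f (k + 1) ω (max (-m.radius k ω) (min (q : ℝ) (m.radius k ω))) :=
    Measurable.iInf fun q => measurable_f_comp h₃ hg k
      (hR.neg.max (measurable_const.min hR))
  refine h.congr_completed ?_
  filter_upwards [hg] with ω g
  obtain ⟨c₁, c₂, -, hc⟩ := g.f_bounds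
  exact (sInf_image_abs_le_eq_iInf (g.f_cont k) (g.radius_nonneg k) fun x hx => (hc k x hx).1).symm

theorem measurable_beta (h₁ : m.RegressorAssumption ℱ ℙ) (h₂ : m.ThresholdAssumption ℱ ℙ M)
    (h₃ : m.NoiseAssumption ℱ ℙ M) (hg : ∀ᵐ ω ∂ℙ, m.GoodPath ω) (k : ℕ)
    (hbar : Measurable[completed (ℱ k) ℙ] (m.thetaBar k)) {t : Ω → Fin d → ℝ}
    (ht : Measurable[completed (ℱ k) ℙ] t) :
    Measurable[completed (ℱ k) ℙ] fun ω => m.beta k ω (t ω) := by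
  have hp := measurable_dot h₁ k ht
  have hq := measurable_dot h₁ k hbar
  have he := measurable_dot h₁ k (hbar.sub ht)
  have hS := measurable_S h₂ k hp
  have hγ := measurable_sens h₁ h₂ k ht
  have h := measurable_ite_eq he (@measurable_const _ _ _ (completed (ℱ k) ℙ) (0 : ℝ))
    (hγ.mul (measurable_f_comp h₃ hg k (hS.sub hp)))
    ((hγ.mul ((measurable_F_comp h₃ hg k (hS.sub hp)).sub
      (measurable_F_comp h₃ hg k (hS.sub hq)))).div he)
  refine h.congr_completed ?_
  filter_upwards [hg] with ω g
  rw [g.beta_eq, ite_not]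
  rfl

theorem measurable_step (h₁ : m.RegressorAssumption ℱ ℙ) (h₂ : m.ThresholdAssumption ℱ ℙ M)
    (h₃ : m.NoiseAssumption ℱ ℙ M) (hg : ∀ᵐ ω ∂ℙ, m.GoodPath ω) (k : ℕ) {μ β : Ω → ℝ}
    (hμ : Measurable[completed (ℱ k) ℙ] μ) (hβ : Measurable[completed (ℱ k) ℙ] β)
    {s : Ω → (Fin d → ℝ) × Matrix (Fin d) (Fin d) ℝ}
    (ht : Measurable[completed (ℱ k) ℙ] fun ω => (s ω).1)
    (hP : ∀ i j, Measurable[completed (ℱ k) ℙ] fun ω => (s ω).2 i j)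
    (hpd : ∀ᵐ ω ∂ℙ, (m.step k ω (μ ω) (β ω) (s ω)).2.PosDef) :
    (Measurable[completed (ℱ (k + 1)) ℙ] fun ω => (m.step k ω (μ ω) (β ω) (s ω)).1) ∧
    ∀ i j, Measurable[completed (ℱ (k + 1)) ℙ] fun ω => (m.step k ω (μ ω) (β ω) (s ω)).2 i j := by
  have hle : completed (ℱ k) ℙ ≤ completed (ℱ (k + 1)) ℙ :=
    completed_mono (ℱ.mono k.le_succ)
  have hφ := (h₁.measurable_φ k).mono (le_completed _ ℙ) le_rfl
  have hb := (h₂.measurable_b k).mono (le_completed _ ℙ) le_rfl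
  have hP' := fun i j => (measurable_gainUpdate_entries hP hφ hμ hβ hb i j).mono hle le_rfl
  refine ⟨?_, hP'⟩
  have hden := hμ.add ((hβ.mul (hb.pow_const 2)).mul
    (measurable_dotProduct hφ (measurable_mulVec hP hφ)))
  have ha := ((@measurable_const _ _ _ (completed (ℱ k) ℙ) (1 : ℝ)).div hden).mul hb
  have hav := (ha.mono hle le_rfl).mul (measurable_innov h₁ h₂ h₃ hg k ht)
  have hx := (ht.mono hle le_rfl).add (hav.smul ((measurable_mulVec hP hφ).mono hle le_rfl))
  have hne : m.D.Nonempty := ⟨m.θ, interior_subset h₁.θ_mem⟩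
  have h := measurable_completed_proj h₁.compact_D hne h₁.convex_D (hpd.mono fun _ h => h.inv)
    (measurable_inv_entries hP') hx
  exact h

/-- The accelerated gain depends on the current estimate, so its measurability is asked for only
given that of the estimate. -/
theorem measurable_recursion (h₁ : m.RegressorAssumption ℱ ℙ)
    (h₂ : m.ThresholdAssumption ℱ ℙ M) (h₃ : m.NoiseAssumption ℱ ℙ M)
    (hg : ∀ᵐ ω ∂ℙ, m.GoodPath ω) {μ β : ℕ → Ω → ℝ}
    {s : Ω → ℕ → (Fin d → ℝ) × Matrix (Fin d) (Fin d) ℝ}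
    (hs : ∀ ω k, s ω (k + 1) = m.step k ω (μ k ω) (β k ω) (s ω k))
    (ht : Measurable[completed (ℱ 0) ℙ] fun ω => (s ω 0).1)
    (hP : ∀ i j, Measurable[completed (ℱ 0) ℙ] fun ω => (s ω 0).2 i j)
    (hμ : ∀ k, Measurable[completed (ℱ k) ℙ] (μ k))
    (hβ : ∀ k, (Measurable[completed (ℱ k) ℙ] fun ω => (s ω k).1) →
      Measurable[completed (ℱ k) ℙ] (β k))
    (hpd : ∀ᵐ ω ∂ℙ, ∀ k, (s ω k).2.PosDef) (k : ℕ) :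
    (Measurable[completed (ℱ k) ℙ] fun ω => (s ω k).1) ∧
    ∀ i j, Measurable[completed (ℱ k) ℙ] fun ω => (s ω k).2 i j := by
  induction k with
  | zero => exact ⟨ht, hP⟩
  | succ k ih =>
    simp only [hs]
    refine measurable_step h₁ h₂ h₃ hg k (hμ k) (hβ k ih.1) ih.1 ih.2 ?_
    filter_upwards [hpd] with ω h
    rw [← hs]
    exact h _

end Adapted

/-! ### The noise deviations as martingale differences -/

section MartingaleDifference

variable {Ω : Type*} [mΩ : MeasurableSpace Ω] {ℙ : Measure Ω} [IsProbabilityMeasure ℙ]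
  {ℱ : Filtration ℕ mΩ} {d : ℕ} {m : Model Ω d} {M : ℝ}

theorem ae_noise_ne_level (h₁ : m.RegressorAssumption ℱ ℙ) (h₂ : m.ThresholdAssumption ℱ ℙ M)
    (h₃ : m.NoiseAssumption ℱ ℙ M) (hg : ∀ᵐ ω ∂ℙ, m.GoodPath ω) (k : ℕ) {t : Ω → Fin d → ℝ}
    (ht : Measurable[completed (ℱ k) ℙ] t) : ∀ᵐ ω ∂ℙ, m.ε (k + 1) ω ≠ m.level k ω (t ω) :=
  ae_ne_of_measurable_completed (ℱ.le k) (h₃.measurable_ε k) (h₃.measurable_F k)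
    (hg.mono fun _ g => g.continuous_F k) (hg.mono fun _ g => g.F_mem k) (h₃.condCDF k)
    (measurable_level h₁ h₂ k ht)

theorem condExp_noiseDev (h₁ : m.RegressorAssumption ℱ ℙ) (h₂ : m.ThresholdAssumption ℱ ℙ M)
    (h₃ : m.NoiseAssumption ℱ ℙ M) (hg : ∀ᵐ ω ∂ℙ, m.GoodPath ω) (k : ℕ) {t : Ω → Fin d → ℝ}
    (ht : Measurable[completed (ℱ k) ℙ] t) :
    ℙ[fun ω => m.noiseDev k ω (t ω) | ℱ k] =ᵐ[ℙ] 0 := by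
  have hX := measurable_level h₁ h₂ k ht
  have hFX := aestronglyMeasurable_of_measurable_completed (measurable_F_comp h₃ hg k hX)
  have hFi : Integrable (fun ω => m.F (k + 1) ω (m.level k ω (t ω))) ℙ :=
    integrable_of_forall_abs_le (hFX.mono (ℱ.le k)) (c := 1) (hg.mono fun ω g => by
      rw [abs_of_nonneg (g.F_mem k _).1]; exact (g.F_mem k _).2)
  have h4 := condExp_indicator_le (ℱ.le k) (h₃.measurable_ε k) (h₃.measurable_F k)
    (hg.mono fun _ g => g.continuous_F k) (hg.mono fun _ g => g.F_mem k) (h₃.condCDF k) hX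
  have h5 := condExp_of_aestronglyMeasurable' (ℱ.le k) hFX hFi
  have h6 := condExp_sub hFi
    (integrable_indicator_le_of_completed (ℱ.le k) (h₃.measurable_ε k) hX) (ℱ k)
  have h7 : (fun ω => m.noiseDev k ω (t ω)) = (fun ω => m.F (k + 1) ω (m.level k ω (t ω))) -
      Set.indicator {ω | m.ε (k + 1) ω ≤ m.level k ω (t ω)} (fun _ => (1 : ℝ)) := by
    ext ω
    simp [noiseDev, Set.indicator]
  rw [h7]
  filter_upwards [h4, h5, h6] with ω h4 h5 h6
  rw [h6, Pi.sub_apply, h4, h5, sub_self, Pi.zero_apply]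

theorem ae_sum_mul_noiseDev_le (h₁ : m.RegressorAssumption ℱ ℙ)
    (h₂ : m.ThresholdAssumption ℱ ℙ M) (h₃ : m.NoiseAssumption ℱ ℙ M)
    (hg : ∀ᵐ ω ∂ℙ, m.GoodPath ω) {t : ℕ → Ω → Fin d → ℝ}
    (ht : ∀ k, Measurable[completed (ℱ k) ℙ] (t k)) {x : ℕ → Ω → ℝ}
    (hx : ∀ k, Measurable[completed (ℱ k) ℙ] (x k)) :
    ∀ᵐ ω ∂ℙ, ∀ η : ℝ, 0 < η → ∃ K : ℝ, ∀ n,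
      ∑ k ∈ Finset.range n, x k ω * m.noiseDev k ω (t k ω) ≤
        η * ∑ k ∈ Finset.range n, x k ω ^ 2 + K := by
  refine ae_sum_mul_le (ℱ := ℱ) (w := fun k ω => m.noiseDev k ω (t k ω))
    (fun k => aestronglyMeasurable_of_measurable_completed (hx k))
    (fun k => ?_) (fun k => ?_) (fun k => condExp_noiseDev h₁ h₂ h₃ hg k (ht k))
  · have hle : completed (ℱ k) ℙ ≤ completed (ℱ (k + 1)) ℙ :=
      completed_mono (ℱ.mono k.le_succ)
    -- The observation, but not the noise, is known at time k + 1. The deviation is recovered from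
    -- the innovation by subtracting its mean and dividing by the sensitivity.
    have h4 := ((measurable_innov h₁ h₂ h₃ hg k (ht k)).sub
      ((measurable_meanInnov h₁ h₂ h₃ hg k (ht k)).mono hle le_rfl)).div
      ((measurable_sens h₁ h₂ k (ht k)).mono hle le_rfl)
    refine aestronglyMeasurable_of_measurable_completed (h4.congr_completed ?_)
    filter_upwards [hg, ae_noise_ne_level h₁ h₂ h₃ hg k (ht k)] with ω g hne
    have hγ := (sens_mem (m := m) k ω (t k ω)).1
    rw [Pi.div_apply, Pi.sub_apply, g.innov_eq k _ hne]
    field_simp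
    ring
  · filter_upwards [hg] with ω g
    have h2 := g.F_mem k (m.level k ω (t k ω))
    unfold noiseDev
    simp only [Set.indicator]
    split_ifs <;> rw [abs_le] <;> constructor <;> linarith

/-- The transform of the noise that enters the energy balance of a recursion is negligible. -/
theorem ae_martingale_bound (h₁ : m.RegressorAssumption ℱ ℙ)
    (h₂ : m.ThresholdAssumption ℱ ℙ M) (h₃ : m.NoiseAssumption ℱ ℙ M)
    (hg : ∀ᵐ ω ∂ℙ, m.GoodPath ω) {t : ℕ → Ω → Fin d → ℝ}
    (ht : ∀ k, Measurable[completed (ℱ k) ℙ] (t k)) {μ : ℕ → Ω → ℝ}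
    (hμ : ∀ k, Measurable[completed (ℱ k) ℙ] (μ k)) :
    ∀ᵐ ω ∂ℙ, ∀ η : ℝ, 0 < η → ∃ K' : ℝ, ∀ n, ∑ k ∈ Finset.range n,
        (-2 * (m.b k ω / μ k ω) * m.sens k ω (t k ω) * (m.φ k ω ⬝ᵥ (m.θ - t k ω))) *
          m.noiseDev k ω (t k ω) ≤
      η * ∑ k ∈ Finset.range n,
        (-2 * (m.b k ω / μ k ω) * m.sens k ω (t k ω) * (m.φ k ω ⬝ᵥ (m.θ - t k ω))) ^ 2 + K' :=
  ae_sum_mul_noiseDev_le h₁ h₂ h₃ hg ht fun k =>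
    (((((h₂.measurable_b k).mono (le_completed _ ℙ) le_rfl).div (hμ k)).const_mul (-2)).mul
      (measurable_sens h₁ h₂ k (ht k))).mul
      (measurable_dot h₁ k (measurable_const.sub (ht k)))

end MartingaleDifference

/-! ### Bounds along the two recursions -/

section Bounds

variable {Ω : Type*} {d : ℕ} {m : Model Ω d} {ω : Ω}

theorem GoodPath.prelim_mem (g : m.GoodPath ω) (h : m.thetaBar₀ ω ∈ m.D) (k : ℕ) :
    m.thetaBar k ω ∈ m.D :=
  g.recursion_mem (s := m.prelim ω) (μ := fun k => m.muBar k ω) (β := fun k => m.betaBar k ω)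
    (fun _ => rfl) h k

theorem GoodPath.accel_mem (g : m.GoodPath ω) (h : m.theta₀ ω ∈ m.D) (k : ℕ) :
    m.theta k ω ∈ m.D :=
  g.recursion_mem (s := m.accel ω) (μ := fun k => m.mu k ω)
    (β := fun k => m.beta k ω (m.accel ω k).1) (fun _ => rfl) h k

theorem GoodPath.exists_betaBar_bounds (g : m.GoodPath ω) :
    ∃ c₁ c₂ : ℝ, 0 < c₁ ∧ ∀ k, c₁ ≤ m.betaBar k ω ∧ m.betaBar k ω ≤ c₂ := by
  obtain ⟨c₁, c₂, hc₁, hc⟩ := g.f_bounds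
  exact ⟨c₁, c₂, hc₁, fun k =>
    ⟨(g.betaBar_bounds k (hc k)).1, (g.betaBar_bounds k (hc k)).2.1⟩⟩

theorem GoodPath.exists_beta_bounds (g : m.GoodPath ω) (h : m.thetaBar₀ ω ∈ m.D)
    (h' : m.theta₀ ω ∈ m.D) :
    ∃ c₁ c₂ : ℝ, 0 < c₁ ∧ ∀ k, c₁ ≤ m.beta k ω (m.accel ω k).1 ∧
      m.beta k ω (m.accel ω k).1 ≤ c₂ := by
  obtain ⟨c₁, c₂, hc₁, hc⟩ := g.f_bounds
  exact ⟨c₁, 2 * c₂, hc₁, fun k => g.beta_bounds k (g.accel_mem h' k) (g.prelim_mem h k) hc₁ (hc k)⟩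

theorem GoodPath.prelim_posDef (g : m.GoodPath ω) (hP : (m.PBar₀ ω).PosDef) {μ₁ : ℝ}
    (hμ₁ : 0 < μ₁) (hμ : ∀ k, μ₁ ≤ m.muBar k ω) (k : ℕ) : (m.prelim ω k).2.PosDef := by
  obtain ⟨c₁, c₂, hc₁, hc⟩ := g.exists_betaBar_bounds
  exact (recursion_inv (s := m.prelim ω) (fun _ => rfl) hP (fun k => hμ₁.trans_le (hμ k))
    (fun k => hc₁.trans_le (hc k).1) k).1

theorem GoodPath.accel_posDef (g : m.GoodPath ω) (h : m.thetaBar₀ ω ∈ m.D)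
    (h' : m.theta₀ ω ∈ m.D) (hP : (m.P₀ ω).PosDef) {μ₁ : ℝ}
    (hμ₁ : 0 < μ₁) (hμ : ∀ k, μ₁ ≤ m.mu k ω) (k : ℕ) : (m.accel ω k).2.PosDef := by
  obtain ⟨c₁, c₂, hc₁, hc⟩ := g.exists_beta_bounds h h'
  exact (recursion_inv (s := m.accel ω) (fun _ => rfl) hP (fun k => hμ₁.trans_le (hμ k))
    (fun k => hc₁.trans_le (hc k).1) k).1

end Bounds

end Model

end TSWLAD

/-! ### The regret bound -/

open TSWLAD Model in
theorem theorem2 {Ω : Type*} [mΩ : MeasurableSpace Ω] (ℙ : Measure Ω) [IsProbabilityMeasure ℙ]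
    (ℱ : Filtration ℕ mΩ) (d : ℕ) (hd : 1 ≤ d) (m : TSWLAD.Model Ω d) (M : ℝ)
    (h₁ : m.RegressorAssumption ℱ ℙ) (h₂ : m.ThresholdAssumption ℱ ℙ M)
    (h₃ : m.NoiseAssumption ℱ ℙ M) (htuning : m.Tuning ℱ ℙ)
    (hcont : ∀ᵐ ω ∂ℙ, ∀ k, m.l k ω = m.L k ω ∧ m.u k ω = m.U k ω) :
    ∀ᵐ ω ∂ℙ, (∃ n, 1 < m.infoMax n ω) →
      (fun n : ℕ => (1 / (n : ℝ)) * ∑ k ∈ Finset.Icc 1 n, m.regret k ω)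
        =O[atTop] (fun n : ℕ => Real.sqrt (Real.log (m.infoMax n ω) / (n : ℝ))) := by
  have hg := ae_goodPath h₁ h₂ h₃ hcont
  have hmuBar := fun k => (htuning.measurable_muBar k).mono (le_completed _ ℙ) le_rfl
  have hmu := fun k => (htuning.measurable_mu k).mono (le_completed _ ℙ) le_rfl
  have hbarm := measurable_recursion h₁ h₂ h₃ hg (s := m.prelim) (μ := m.muBar) (β := m.betaBar)
    (fun _ _ => rfl) (htuning.measurable_thetaBar₀.mono (le_completed _ ℙ) le_rfl)
    (fun i j => (htuning.measurable_PBar₀ i j).mono (le_completed _ ℙ) le_rfl) hmuBar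
    (fun k _ => measurable_betaBar h₁ h₂ h₃ hg k) (by
      filter_upwards [hg, htuning.PBar₀_posDef, htuning.muBar_bounds] with ω g hP hμ k
      obtain ⟨μ₁, μ₂, hμ₁, hμ⟩ := hμ
      exact g.prelim_posDef hP hμ₁ (fun k => (hμ k).1) k)
  have haccm := measurable_recursion h₁ h₂ h₃ hg (s := m.accel) (μ := m.mu)
    (β := fun k ω => m.beta k ω (m.accel ω k).1)
    (fun _ _ => rfl) (htuning.measurable_theta₀.mono (le_completed _ ℙ) le_rfl)
    (fun i j => (htuning.measurable_P₀ i j).mono (le_completed _ ℙ) le_rfl) hmu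
    (fun k ht => measurable_beta h₁ h₂ h₃ hg k (hbarm k).1 ht) (by
      filter_upwards [hg, htuning.P₀_posDef, htuning.mu_bounds, htuning.theta₀_mem,
        htuning.thetaBar₀_mem] with ω g hP hμ h' h k
      obtain ⟨μ₁, μ₂, hμ₁, hμ⟩ := hμ
      exact g.accel_posDef h h' hP hμ₁ (fun k => (hμ k).1) k)
  have hmartBar := ae_martingale_bound h₁ h₂ h₃ hg (fun k => (hbarm k).1) hmuBar
  have hmart := ae_martingale_bound h₁ h₂ h₃ hg (fun k => (haccm k).1) hmu
  have hneBar := ae_all_iff.2 fun k => ae_noise_ne_level h₁ h₂ h₃ hg k (hbarm k).1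
  have hne := ae_all_iff.2 fun k => ae_noise_ne_level h₁ h₂ h₃ hg k (haccm k).1
  -- From here the path is fixed and the argument deterministic.
  filter_upwards [hg, htuning.PBar₀_posDef, htuning.muBar_bounds, htuning.P₀_posDef,
    htuning.mu_bounds, htuning.theta₀_mem, htuning.thetaBar₀_mem, hmartBar, hmart, hneBar, hne]
    with ω g hPBar hμBar hP hμ h0 h0Bar hmartBar hmart hneBar hne ⟨n₀, hn₀⟩
  obtain ⟨c₁, c₂, hc₁, hc⟩ := g.f_bounds
  obtain ⟨μ₁, μ₂, hμ₁, hμ⟩ := hμ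
  obtain ⟨ν₁, ν₂, hν₁, hν⟩ := hμBar
  obtain ⟨β₁, β₂, hβ₁, hβ⟩ := g.exists_beta_bounds h0Bar h0
  obtain ⟨γ₁, γ₂, hγ₁, hγ⟩ := g.exists_betaBar_bounds
  have hmemBar := g.prelim_mem h0Bar
  have hmem := g.accel_mem h0
  obtain ⟨A₁, B₁, hA₁, hB₁, hsumBar⟩ := g.sum_sq_le_of_recursion (s := m.prelim ω)
    (β := fun k => m.betaBar k ω) (fun _ => rfl) hPBar hν₁ hν hγ₁ (fun k => (hγ k).1) hneBar hc₁
    le_rfl (q := fun _ => 0)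
    (fun k => by
      have := g.prelim_drift k (hmemBar k) hc₁ (hc k)
      rw [zero_mul, sub_zero]
      exact this) hmartBar
  obtain ⟨A₂, B₂, hA₂, hB₂, hsum⟩ := g.sum_sq_le_of_recursion (s := m.accel ω)
    (β := fun k => m.beta k ω (m.accel ω k).1) (fun _ => rfl) hP hμ₁ hμ hβ₁ (fun k => (hβ k).1)
    hne (half_pos hc₁) (K := 8 * c₂ ^ 2 / c₁) (by positivity)
    (q := fun k => m.φ k ω ⬝ᵥ (m.θ - m.thetaBar k ω))
    (fun k => g.accel_drift k (hmem k) (hmemBar k) hc₁ (hc k)) hmart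
  obtain ⟨A₃, hA₃, hdetBar⟩ := g.log_det_le hd hP (s := m.prelim ω) (fun _ => rfl) hPBar hν₁
    (fun k => (hν k).1) (β := fun k => m.betaBar k ω)
    (fun k => ⟨hγ₁.trans_le (hγ k).1, (hγ k).2⟩)
  obtain ⟨A₄, hA₄, hdet⟩ := g.log_det_le hd hP (s := m.accel ω) (fun _ => rfl) hP hμ₁
    (fun k => (hμ k).1) (β := fun k => m.beta k ω (m.accel ω k).1)
    (fun k => ⟨hβ₁.trans_le (hβ k).1, (hβ k).2⟩)
  set Λ₁ := Real.log (m.prelim ω 0).2⁻¹.det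
  set Λ₂ := Real.log (m.accel ω 0).2⁻¹.det
  set ℓ := Real.log (m.infoMax n₀ ω) with hℓ
  have hℓ0 : 0 < ℓ := Real.log_pos hn₀
  set E := |A₂ + B₂ * (A₄ - Λ₂) + B₂ * (A₁ + B₁ * (A₃ - Λ₁))| with hE
  set G := B₂ * d + B₂ * (B₁ * d) with hG
  -- After n₀ monotonicity gives log λ_max(n) ≥ ℓ > 0, so the additive constant E is at most (E/ℓ)
  -- log λ_max(n).
  refine g.averaged_regret_isBigO (K := E / ℓ + G) (n₀ := n₀) (by positivity) fun n hn => ?_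
  have hmono := infoMax_mono (m := m) hd hP hn
  have hlogn : ℓ ≤ Real.log (m.infoMax n ω) := Real.log_le_log (by linarith) hmono
  have hone : 1 ≤ m.infoMax n ω := hn₀.le.trans hmono
  have h5 := hsumBar (n + 1)
  have h6 := hsum (n + 1)
  have h7 := mul_le_mul_of_nonneg_left (hdetBar n hone) hB₁
  have h8 := mul_le_mul_of_nonneg_left (hdet n hone) hB₂
  have h9 : ∑ k ∈ Finset.range (n + 1), (m.φ k ω ⬝ᵥ (m.θ - m.thetaBar k ω)) ^ 2 ≤
      A₁ + B₁ * (A₃ - Λ₁) + B₁ * d * Real.log (m.infoMax n ω) := by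
    have : ∑ k ∈ Finset.range (n + 1), ((fun _ => (0 : ℝ)) k) ^ 2 = 0 := by simp
    rw [this] at h5
    refine le_trans h5 ?_
    linarith
  have h10 := mul_le_mul_of_nonneg_left h9 hB₂
  have h11 : ∑ k ∈ Finset.range (n + 1), (m.φ k ω ⬝ᵥ (m.θ - m.theta k ω)) ^ 2 ≤
      E + G * Real.log (m.infoMax n ω) := by
    refine le_trans h6 ?_
    have := le_abs_self (A₂ + B₂ * (A₄ - Λ₂) + B₂ * (A₁ + B₁ * (A₃ - Λ₁)))
    rw [hG]
    linarith
  have h12 : E ≤ E / ℓ * Real.log (m.infoMax n ω) := by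
    calc E = E / ℓ * ℓ := by field_simp
      _ ≤ _ := mul_le_mul_of_nonneg_left hlogn (by positivity)
  linarith
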